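/- Let $k$ be a field of characteristic zero. A Poisson algebra is a commutative $k$-algebra with a $k$-bilinear Lie bracket $\{-,-\}$ that is a derivation in each variable. For a Poisson algebra $B$, a Poisson derivation $\alpha$ of $B$ (a $k$-linear derivation of the product with $\alpha(\{a,b\})=\{\alpha(a),b\}+\{a,\alpha(b)\}$) and a $k$-linear derivation $\delta$ of $B$ with $\delta(\{a,b\})=\{\delta(a),b\}+\{a,\delta(b)\}+\alpha(a)\delta(b)-\delta(a)\alpha(b)$, let $B[x;\alpha,\delta]_p$ denote the polynomial ring $B[x]$ with the unique Poisson bracket that extends that of $B$ and satisfies $\{x,b\}=\alpha(b)x+\delta(b)$ for all $b\in B$. **Corollary 1.8.** Let $A=k[x_1][x_2;\alpha_2,\delta_2]_p\cdots[x_n;\alpha_n,\delta_n]_p$ be an iterated Poisson polynomial algebra. Suppose that a torus $H=(k^\times)^r$ acts on $A$ by Poisson automorphisms ($k$-algebra automorphisms preserving the bracket), that the action is rational (i.e. $A$ is generated as a $k$-algebra by $H$-eigenvectors whose eigenvalues are rational characters $h\mapsto h_1^{m_1}\cdots h_r^{m_r}$, $m\in\mathbb Z^r$), and that $x_1,\dots,x_n$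 are $H$-eigenvectors. Let $\mathfrak h=\operatorname{Lie}H=k^r$ act on $A$ by the differential of the $H$-action, that is, $\eta.a=\bigl(\sum_i\eta_i m_i\bigr)a$ whenever $h.a=h_1^{m_1}\cdots h_r^{m_r}a$ for all $h\in H$. Assume that there are $\eta_1,\dots,\eta_n\in\mathfrak h$ such that $\eta_i.x_j=\alpha_i(x_j)$ for all $i>j$ and such that the $\eta_i$-eigenvalue of $x_i$ is nonzero for each $i$. Then $A$ satisfies the Poisson Dixmier–Moeglin equivalence, that is, the following three sets of ideals of $A$ coincide: 1. the Poisson primitive ideals, i.e. the Poisson cores of the maximal ideals of $A$, where a Poisson ideal is an ideal $I$ with $\{A,I\}\subseteq I$ and the Poisson core of an ideal $J$ is the largest Poisson ideal contained in $J$; 2. the locally closed points of $\operatorname{P.spec}A$, the set of prime Poisson ideals of $A$ with the topology induced by the Zariski topology of $\operatorname{spec}A$; 3. the Poisson rational Poisson primes, i.e. the prime Poisson ideals $P$ such that the Poisson center $\{z\mid\{z,-\}=0\}$ of the quotient field $\operatorname{Fract}(A/P)$, with the bracket induced from $A$, is algebraic over $k$. -/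

import Mathlib

noncomputable section

set_option linter.unusedSectionVars false

/-! ### Extending derivations to the quotient field -/

/-- The extension to the quotient field `K` of `B` of a derivation from `B` to a `K`-vector
space. -/
def Derivation.extendToFractions {k B M : Type*} (K : Type*) [CommRing k] [CommRing B]
    [Algebra k B] [Field K] [Algebra B K] [IsFractionRing B K] [Algebra k K]
    [IsScalarTower k B K] [AddCommGroup M] [Module k M] [Module B M] [Module K M]
    [IsScalarTower k B M] [IsScalarTower B K M] [IsScalarTower k K M]
    (d : Derivation k B M) : Derivation k K M :=
  haveI : Algebra.FormallyEtale B K :=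
    Algebra.FormallyEtale.of_isLocalization (nonZeroDivisors B)
  ((d.liftKaehlerDifferential.liftBaseChange K) ∘ₗ
    (KaehlerDifferential.tensorKaehlerEquivOfFormallyEtale k B K).symm.toLinearMap).compDer
      (KaehlerDifferential.D k K)

theorem Derivation.extendToFractions_algebraMap {k B K M : Type*} [CommRing k] [CommRing B]
    [Algebra k B] [Field K] [Algebra B K] [IsFractionRing B K] [Algebra k K]
    [IsScalarTower k B K] [AddCommGroup M] [Module k M] [Module B M] [Module K M]
    [IsScalarTower k B M] [IsScalarTower B K M] [IsScalarTower k K M]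
    (d : Derivation k B M) (b : B) : d.extendToFractions K (algebraMap B K b) = d b := by
  have : Algebra.FormallyEtale B K :=
    Algebra.FormallyEtale.of_isLocalization (nonZeroDivisors B)
  simp [Derivation.extendToFractions,
    KaehlerDifferential.tensorKaehlerEquivOfFormallyEtale_symm_D_algebraMap]

/-- A derivation on the quotient field of `B` is determined by its values on `B`. -/
theorem Derivation.eq_of_eq_on_base {k K M : Type*} (B : Type*) [CommRing k] [CommRing B]
    [IsDomain B] [Field K] [Algebra B K] [IsFractionRing B K] [Algebra k K]
    [AddCommGroup M] [Module k M] [Module K M] {D₁ D₂ : Derivation k K M}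
    (h : ∀ b : B, D₁ (algebraMap B K b) = D₂ (algebraMap B K b)) : D₁ = D₂ := by
  ext x
  obtain ⟨a, s, hs, rfl⟩ := IsFractionRing.div_surjective (A := B) x
  have hs' : algebraMap B K s ≠ 0 := IsFractionRing.to_map_ne_zero_of_mem_nonZeroDivisors hs
  have e : algebraMap B K s * (algebraMap B K a / algebraMap B K s) = algebraMap B K a := by
    field_simp
  have h1 := D₁.leibniz (algebraMap B K s) (algebraMap B K a / algebraMap B K s)
  have h2 := D₂.leibniz (algebraMap B K s) (algebraMap B K a / algebraMap B K s)
  rw [e] at h1 h2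
  rw [h a, h2, h s] at h1
  exact (smul_right_injective M hs' (add_right_cancel h1)).symm

/-! ### Poisson brackets -/

/-- A Poisson bracket on the commutative `k`-algebra `A`: a `k`-bilinear Lie bracket that is a
derivation in each variable (in the first one by antisymmetry). -/
structure PoissonBracket (k A : Type*) [CommRing k] [CommRing A] [Algebra k A] where
  bracket : A →ₗ[k] A →ₗ[k] A
  self' : ∀ a, bracket a a = 0
  jacobi' : ∀ a b c, bracket a (bracket b c) + bracket b (bracket c a) + bracket c (bracket a b) = 0
  leibniz' : ∀ a b c, bracket a (b * c) = bracket a b * c + b * bracket a c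

namespace PoissonBracket

variable {k A : Type*} [CommRing k] [CommRing A] [Algebra k A]

variable (π : PoissonBracket k A)

theorem self (a : A) : π.bracket a a = 0 := π.self' a

theorem jacobi (a b c : A) : π.bracket a (π.bracket b c) + π.bracket b (π.bracket c a) + π.bracket c (π.bracket a b) = 0 := π.jacobi' a b c

theorem leibniz (a b c : A) : π.bracket a (b * c) = π.bracket a b * c + b * π.bracket a c := π.leibniz' a b c

theorem skew (a b : A) : π.bracket a b = -π.bracket b a := by
  have h := π.self (a + b)
  simp only [map_add, LinearMap.add_apply, π.self, zero_add, add_zero] at h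
  exact eq_neg_of_add_eq_zero_right h

theorem leibniz_left (a b c : A) : π.bracket (a * b) c = a * π.bracket b c + π.bracket a c * b := by
  rw [π.skew, π.leibniz, π.skew c a, π.skew c b]; ring

/-- The derivation `{a, -}`. -/
def ham (a : A) : Derivation k A A :=
  Derivation.mk' (π.bracket a) (fun b c => by
    simp only [smul_eq_mul]; rw [π.leibniz]; ring)

@[simp] theorem ham_apply (a b : A) : π.ham a b = π.bracket a b := rfl

/-! ### Poisson ideals, Poisson primitive ideals, the Poisson prime spectrum -/

/-- An ideal `I` with `{A, I} ⊆ I`. -/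
def IsPoissonIdeal (I : Ideal A) : Prop := ∀ a, ∀ b ∈ I, π.bracket a b ∈ I

/-- The largest Poisson ideal contained in `J`. -/
def core (J : Ideal A) : Ideal A := sSup {I | π.IsPoissonIdeal I ∧ I ≤ J}

theorem isGreatest_core (J : Ideal A) :
    IsGreatest {I | π.IsPoissonIdeal I ∧ I ≤ J} (π.core J) := by
  refine ⟨⟨fun a b hb => ?_, sSup_le fun I hI => hI.2⟩, fun I hI => le_sSup hI⟩
  unfold core at hb ⊢
  rw [sSup_eq_iSup'] at hb ⊢
  induction hb using Submodule.iSup_induction' with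
  | mem I x hx =>
    have hle : I.1 ≤ ⨆ I : {I | π.IsPoissonIdeal I ∧ I ≤ J}, I.1 :=
      le_iSup (fun I : {I | π.IsPoissonIdeal I ∧ I ≤ J} => I.1) I
    exact hle (I.2.1 a x hx)
  | zero => simp
  | add x y _ _ h1 h2 => rw [map_add]; exact add_mem h1 h2

/-- The Poisson primitive ideals are the Poisson cores of the maximal ideals. -/
def IsPoissonPrimitive (P : Ideal A) : Prop := ∃ M : Ideal A, M.IsMaximal ∧ P = π.core M

/-- The Poisson prime spectrum, with the subspace topology of the Zariski topology. -/
abbrev PSpec : Type _ := {p : PrimeSpectrum A // π.IsPoissonIdeal p.asIdeal}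

/-! ### The bracket induced on a quotient -/

theorem mk_bracket_eq {I : Ideal A} (hI : π.IsPoissonIdeal I) {a a' b b' : A}
    (ha : Ideal.Quotient.mk I a = Ideal.Quotient.mk I a')
    (hb : Ideal.Quotient.mk I b = Ideal.Quotient.mk I b') :
    Ideal.Quotient.mk I (π.bracket a b) = Ideal.Quotient.mk I (π.bracket a' b') := by
  rw [Ideal.Quotient.eq] at ha hb ⊢
  have e : π.bracket a b - π.bracket a' b' = π.bracket a (b - b') - π.bracket b' (a - a') := by
    rw [π.skew b' (a - a')]
    simp only [map_sub, LinearMap.sub_apply]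
    ring
  rw [e]
  exact sub_mem (hI _ _ hb) (hI _ _ ha)

/-- The Poisson bracket on `A ⧸ I` induced by the one on `A`, for a Poisson ideal `I`. -/
def quotient {I : Ideal A} (hI : π.IsPoissonIdeal I) : PoissonBracket k (A ⧸ I) :=
  have key : ∀ a b : A, Ideal.Quotient.mk I (π.bracket (Quotient.out (Ideal.Quotient.mk I a))
      (Quotient.out (Ideal.Quotient.mk I b))) = Ideal.Quotient.mk I (π.bracket a b) := fun a b =>
    π.mk_bracket_eq hI (Ideal.Quotient.mk_out _) (Ideal.Quotient.mk_out _)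
  have hsm : ∀ (c : k) (a : A),
      c • Ideal.Quotient.mk I a = Ideal.Quotient.mk I (c • a) := fun _ _ => rfl
  have hs := Ideal.Quotient.mk_surjective (I := I)
  { bracket := LinearMap.mk₂ k
      (fun x y => Ideal.Quotient.mk I (π.bracket (Quotient.out x) (Quotient.out y)))
      (by
        intro x y z
        obtain ⟨x, rfl⟩ := hs x
        obtain ⟨y, rfl⟩ := hs y
        obtain ⟨z, rfl⟩ := hs z
        rw [← map_add, key, key, key, ← map_add]; simp)
      (by
        intro c x y
        obtain ⟨x, rfl⟩ := hs x
        obtain ⟨y, rfl⟩ := hs y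
        rw [hsm, key, key, hsm]; simp)
      (by
        intro x y z
        obtain ⟨x, rfl⟩ := hs x
        obtain ⟨y, rfl⟩ := hs y
        obtain ⟨z, rfl⟩ := hs z
        rw [← map_add, key, key, key, ← map_add]; simp)
      (by
        intro c x y
        obtain ⟨x, rfl⟩ := hs x
        obtain ⟨y, rfl⟩ := hs y
        rw [hsm, key, key, hsm]; simp)
    self' := by
      intro x
      obtain ⟨x, rfl⟩ := hs x
      rw [LinearMap.mk₂_apply, key, π.self, map_zero]
    jacobi' := by
      intro x y z
      obtain ⟨x, rfl⟩ := hs x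
      obtain ⟨y, rfl⟩ := hs y
      obtain ⟨z, rfl⟩ := hs z
      simp only [LinearMap.mk₂_apply, key]
      rw [← map_add, ← map_add, π.jacobi, map_zero]
    leibniz' := by
      intro x y z
      obtain ⟨x, rfl⟩ := hs x
      obtain ⟨y, rfl⟩ := hs y
      obtain ⟨z, rfl⟩ := hs z
      simp only [LinearMap.mk₂_apply, ← map_mul, key]
      rw [← map_add, π.leibniz] }

theorem quotient_mk {I : Ideal A} (hI : π.IsPoissonIdeal I) (a b : A) :
    (π.quotient hI).bracket (Ideal.Quotient.mk I a) (Ideal.Quotient.mk I b) =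
      Ideal.Quotient.mk I (π.bracket a b) :=
  π.mk_bracket_eq hI (Ideal.Quotient.mk_out _) (Ideal.Quotient.mk_out _)

/-! ### The bracket induced on the quotient field -/

section Fractions

variable {B : Type*} [CommRing B] [IsDomain B] [Algebra k B] (σ : PoissonBracket k B)
  (K : Type*) [Field K] [Algebra B K] [IsFractionRing B K] [Algebra k K] [IsScalarTower k B K]

/-- The derivation of `K` extending `{b, -}`. -/
def hamFrac (b : B) : Derivation k K K :=
  ((Algebra.linearMap B K).compDer (σ.ham b)).extendToFractions K

theorem hamFrac_algebraMap (b c : B) :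
    σ.hamFrac K b (algebraMap B K c) = algebraMap B K (σ.bracket b c) := by
  rw [hamFrac, Derivation.extendToFractions_algebraMap]; simp

/-- The map `b ↦ {b, -}`, as a derivation from `B` to the `K`-space of derivations of `K`. -/
def hamFracDer : Derivation k B (Derivation k K K) :=
  Derivation.mk'
    { toFun := σ.hamFrac K
      map_add' := fun a b => Derivation.eq_of_eq_on_base B fun c => by
        simp [hamFrac_algebraMap]
      map_smul' := fun r a => Derivation.eq_of_eq_on_base B fun c => by
        rw [hamFrac_algebraMap, map_smul, LinearMap.smul_apply, RingHom.id_apply,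
          Derivation.smul_apply, hamFrac_algebraMap, Algebra.smul_def, Algebra.smul_def, map_mul,
          ← IsScalarTower.algebraMap_apply] }
    (fun a b => Derivation.eq_of_eq_on_base B fun c => by
      simp [hamFrac_algebraMap, Algebra.smul_def, σ.leibniz_left, mul_comm])

theorem hamFracDer_algebraMap (b c : B) :
    σ.hamFracDer K b (algebraMap B K c) = algebraMap B K (σ.bracket b c) :=
  σ.hamFrac_algebraMap K b c

/-- The map `x ↦ {x, -}` on `K`. -/
def fracDer : Derivation k K (Derivation k K K) := (σ.hamFracDer K).extendToFractions K

theorem fracDer_algebraMap (b c : B) :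
    σ.fracDer K (algebraMap B K b) (algebraMap B K c) = algebraMap B K (σ.bracket b c) := by
  rw [fracDer, Derivation.extendToFractions_algebraMap, hamFracDer_algebraMap]

/-- Evaluation at `y` of derivation-valued derivations. -/
def evalDer (D : Derivation k K (Derivation k K K)) (y : K) : Derivation k K K :=
  Derivation.mk' { toFun := fun x => D x y, map_add' := by simp, map_smul' := by simp }
    (fun a b => by simp)

theorem fracDer_skew (x y : K) : σ.fracDer K x y = -σ.fracDer K y x := by
  have h1 : ∀ (b : B) (y : K),
      σ.fracDer K (algebraMap B K b) y = -σ.fracDer K y (algebraMap B K b) := fun b y => by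
    have : σ.fracDer K (algebraMap B K b) = -evalDer K (σ.fracDer K) (algebraMap B K b) :=
      Derivation.eq_of_eq_on_base B fun c => by
        change _ = -(σ.fracDer K (algebraMap B K c) (algebraMap B K b))
        rw [fracDer_algebraMap, fracDer_algebraMap, σ.skew, map_neg]
    exact congrArg (fun D : Derivation k K K => D y) this
  have : σ.fracDer K x = -evalDer K (σ.fracDer K) x :=
    Derivation.eq_of_eq_on_base B fun c => by
      change _ = -(σ.fracDer K (algebraMap B K c) x)
      rw [h1 c x, neg_neg]
  exact congrArg (fun D : Derivation k K K => D y) this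

theorem fracDer_self (x : K) : σ.fracDer K x x = 0 := by
  obtain ⟨a, s, hs, rfl⟩ := IsFractionRing.div_surjective (A := B) x
  have hs' : algebraMap B K s ≠ 0 := IsFractionRing.to_map_ne_zero_of_mem_nonZeroDivisors hs
  set S := algebraMap B K s
  set y := algebraMap B K a / S
  have e : S * y = algebraMap B K a := by simp only [y]; field_simp
  have h0 : σ.fracDer K (algebraMap B K a) (algebraMap B K a) = 0 := by
    rw [fracDer_algebraMap, σ.self, map_zero]
  have hS : σ.fracDer K S S = 0 := by
    simp only [S]; rw [fracDer_algebraMap, σ.self, map_zero]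
  rw [← e] at h0
  simp only [Derivation.leibniz, Derivation.add_apply, Derivation.smul_apply, smul_eq_mul,
    hS] at h0
  rw [σ.fracDer_skew K S y] at h0
  have : S * S * σ.fracDer K y y = 0 := by linear_combination h0
  simpa [hs'] using this

/-- The Jacobi sum `{x,{y,z}} + {y,{z,x}} + {z,{x,y}}`, as a derivation in `x`. -/
def jacobiDer (y z : K) : Derivation k K K :=
  Derivation.mk'
    { toFun := fun x => σ.fracDer K x (σ.fracDer K y z) + σ.fracDer K y (σ.fracDer K z x) +
        σ.fracDer K z (σ.fracDer K x y)
      map_add' := fun a b => by simp only [map_add, Derivation.add_apply]; ring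
      map_smul' := fun r a => by
        simp only [Derivation.smul_apply, Derivation.map_smul, RingHom.id_apply,
          smul_add] }
    (fun a b => by
      simp only [LinearMap.coe_mk, AddHom.coe_mk, Derivation.leibniz, Derivation.add_apply,
        Derivation.smul_apply, smul_eq_mul, map_add]
      rw [σ.fracDer_skew K a y, σ.fracDer_skew K b y]
      simp only [map_neg]
      ring)

theorem fracDer_jacobi (x y z : K) :
    σ.fracDer K x (σ.fracDer K y z) + σ.fracDer K y (σ.fracDer K z x) +
      σ.fracDer K z (σ.fracDer K x y) = 0 := by
  have cyc : ∀ x y z : K, σ.jacobiDer K y z x = σ.jacobiDer K z x y := fun x y z => by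
    change σ.fracDer K x (σ.fracDer K y z) + σ.fracDer K y (σ.fracDer K z x) +
        σ.fracDer K z (σ.fracDer K x y) =
      σ.fracDer K y (σ.fracDer K z x) + σ.fracDer K z (σ.fracDer K x y) +
        σ.fracDer K x (σ.fracDer K y z)
    ring
  have ext0 : ∀ y z : K, (∀ b : B, σ.jacobiDer K y z (algebraMap B K b) = 0) →
      ∀ x, σ.jacobiDer K y z x = 0 := fun y z h x => by
    rw [Derivation.eq_of_eq_on_base B (D₁ := σ.jacobiDer K y z) (D₂ := 0) (by simpa using h)]
    rfl
  have h3 : ∀ b c d : B,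
      σ.jacobiDer K (algebraMap B K b) (algebraMap B K c) (algebraMap B K d) = 0 :=
    fun b c d => by
      change σ.fracDer K _ (σ.fracDer K _ _) + σ.fracDer K _ (σ.fracDer K _ _) +
        σ.fracDer K _ (σ.fracDer K _ _) = 0
      simp only [fracDer_algebraMap]
      rw [← map_add, ← map_add, σ.jacobi, map_zero]
  have h2 : ∀ (b c : B) (x : K), σ.jacobiDer K (algebraMap B K b) (algebraMap B K c) x = 0 :=
    fun b c => ext0 _ _ (h3 b c)
  have h1 : ∀ (c : B) (x y : K), σ.jacobiDer K (algebraMap B K c) x y = 0 :=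
    fun c x => ext0 _ _ fun b => by rw [cyc, cyc]; exact h2 b c x
  exact ext0 y z (fun b => by rw [cyc, cyc]; exact h1 b y z) x

/-- The extension of a Poisson bracket on a domain `B` to its quotient field `K`. -/
def fractions : PoissonBracket k K where
  bracket := LinearMap.mk₂ k (fun x y => σ.fracDer K x y) (by simp) (by simp) (by simp) (by simp)
  self' := σ.fracDer_self K
  jacobi' := σ.fracDer_jacobi K
  leibniz' a b c := by simp; ring

/-- It extends the bracket of `B`, and is the only Poisson bracket on `K` that does so. -/
theorem eq_fractions_iff (τ : PoissonBracket k K) :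
    τ = σ.fractions K ↔
      ∀ b c : B, τ.bracket (algebraMap B K b) (algebraMap B K c) =
        algebraMap B K (σ.bracket b c) := by
  constructor
  · rintro rfl b c
    exact σ.fracDer_algebraMap K b c
  · intro h
    have h1 : ∀ b : B, τ.ham (algebraMap B K b) = (σ.fractions K).ham (algebraMap B K b) :=
      fun b => Derivation.eq_of_eq_on_base B fun c =>
        (h b c).trans (σ.fracDer_algebraMap K b c).symm
    have h2 : ∀ x : K, τ.ham x = (σ.fractions K).ham x := fun x =>
      Derivation.eq_of_eq_on_base B fun c => by
        rw [ham_apply, ham_apply, τ.skew, (σ.fractions K).skew]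
        exact congrArg (fun D : Derivation k K K => -D x) (h1 c)
    have h3 : τ.bracket = (σ.fractions K).bracket :=
      LinearMap.ext fun x => LinearMap.ext fun y =>
        congrArg (fun D : Derivation k K K => D y) (h2 x)
    cases τ
    cases hσ : σ.fractions K
    rw [hσ] at h3
    cases h3
    rfl

end Fractions

/-! ### The Poisson center and the Poisson Dixmier-Moeglin equivalence -/

/-- The Poisson center `{z | {z, -} = 0}`. -/
def center : Subalgebra k A where
  carrier := {z | ∀ a, π.bracket z a = 0}
  mul_mem' {x y} hx hy a := by
    rw [π.leibniz_left, hx a, hy a, mul_zero, zero_mul, add_zero]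
  add_mem' {x y} hx hy a := by
    rw [map_add, LinearMap.add_apply, hx a, hy a, add_zero]
  algebraMap_mem' r a := by
    rw [π.skew]
    exact neg_eq_zero.mpr ((π.ham a).map_algebraMap r)

/-- The Poisson bracket on the quotient field of `A ⧸ P`, for a Poisson prime `P`. -/
def residueBracket (P : π.PSpec) : PoissonBracket k (FractionRing (A ⧸ P.1.asIdeal)) :=
  (π.quotient P.2).fractions (FractionRing (A ⧸ P.1.asIdeal))

/-- `P` is Poisson rational if the Poisson center of the quotient field of `A ⧸ P` is algebraic
over `k`. -/
def IsPoissonRational (P : π.PSpec) : Prop := Algebra.IsAlgebraic k (π.residueBracket P).center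

/-- The Poisson primitive ideals, the locally closed points of the Poisson prime spectrum, and
the Poisson rational Poisson primes form the same set of ideals. -/
def DixmierMoeglinEquivalence : Prop :=
  {I : Ideal A | π.IsPoissonPrimitive I} =
      {I | ∃ P : π.PSpec, IsLocallyClosed {P} ∧ P.1.asIdeal = I} ∧
    {I : Ideal A | ∃ P : π.PSpec, IsLocallyClosed {P} ∧ P.1.asIdeal = I} =
      {I | ∃ P : π.PSpec, π.IsPoissonRational P ∧ P.1.asIdeal = I}

/-! ### Iterated Poisson polynomial algebras -/

/-- A subalgebra closed under the bracket. -/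
def IsPoissonSubalgebra (B : Subalgebra k A) : Prop :=
  ∀ a ∈ B, ∀ b ∈ B, π.bracket a b ∈ B

/-- The bracket of a Poisson subalgebra. -/
def restrict {B : Subalgebra k A} (hB : π.IsPoissonSubalgebra B) : PoissonBracket k B where
  bracket := LinearMap.mk₂ k (fun a b => ⟨π.bracket a b, hB a a.2 b b.2⟩)
    (fun _ _ _ => Subtype.ext (by simp)) (fun _ _ _ => Subtype.ext (by simp))
    (fun _ _ _ => Subtype.ext (by simp)) (fun _ _ _ => Subtype.ext (by simp))
  self' a := Subtype.ext (π.self a)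
  jacobi' a b c := Subtype.ext (π.jacobi a b c)
  leibniz' a b c := Subtype.ext (π.leibniz a b c)

/-- A derivation for the multiplication that is also a derivation for the bracket. -/
def IsPoissonDerivation (α : Derivation k A A) : Prop :=
  ∀ a b, α (π.bracket a b) = π.bracket (α a) b + π.bracket a (α b)

/-- The conditions on `α` and `δ` under which a Poisson polynomial algebra `A[x; α, δ]` exists. -/
structure IsPoissonPolynomialDatum (α δ : Derivation k A A) : Prop where
  isPoissonDerivation : π.IsPoissonDerivation α
  map_bracket : ∀ a b, δ (π.bracket a b) =
    π.bracket (δ a) b + π.bracket a (δ b) + α a * δ b - δ a * α b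

end PoissonBracket

open MvPolynomial in
/-- The polynomial algebra `k[x₀, …, xₙ₋₁]` with the bracket `π` is the iterated Poisson
polynomial algebra `k[x₀][x₁; α₁, δ₁] ⋯ [xₙ₋₁; αₙ₋₁, δₙ₋₁]`. Here `supported k (Set.Iio i)` is the
subalgebra `k[x₀, …, xᵢ₋₁]`; it equals `k` for `i = 0`, so that `α₀` and `δ₀` are zero. -/
structure IsIteratedPoissonPolynomialAlgebra {k : Type*} [Field k] {n : ℕ}
    (π : PoissonBracket k (MvPolynomial (Fin n) k))
    (α δ : ∀ i : Fin n, Derivation k (supported k (Set.Iio i)) (supported k (Set.Iio i))) :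
    Prop where
  isPoissonSubalgebra : ∀ i : Fin n, π.IsPoissonSubalgebra (supported k (Set.Iio i))
  isDatum : ∀ i : Fin n,
    (π.restrict (isPoissonSubalgebra i)).IsPoissonPolynomialDatum (α i) (δ i)
  bracket_X : ∀ (i : Fin n) (b : supported k (Set.Iio i)),
    π.bracket (X i) (b : MvPolynomial (Fin n) k) =
      (α i b : MvPolynomial (Fin n) k) * X i + (δ i b : MvPolynomial (Fin n) k)

/-! ### Torus actions -/

/-- The algebraic torus of rank `r`, as the group of its `k`-points. -/
abbrev Torus (k : Type*) [Field k] (r : ℕ) : Type _ := Fin r → kˣ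

namespace Torus

variable {k A : Type*} [Field k] [CommRing A] [Algebra k A] {r : ℕ}

/-- The rational character of the torus with exponents `m`. -/
def character (m : Fin r → ℤ) : Torus k r →* kˣ where
  toFun h := ∏ i, h i ^ m i
  map_one' := by simp
  map_mul' h h' := by simp [mul_zpow, Finset.prod_mul_distrib]

variable (ρ : Torus k r →* (A ≃ₐ[k] A))

/-- The eigenspace of the rational character with exponents `m`. -/
def eigenspace (m : Fin r → ℤ) : Submodule k A where
  carrier := {a | ∀ h, ρ h a = (character m h : k) • a}
  add_mem' {a b} ha hb h := by rw [map_add, ha h, hb h, smul_add]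
  zero_mem' h := by simp
  smul_mem' c a ha h := by rw [map_smul, ha h, smul_comm]

/-- The action is rational: `A` is generated, as an algebra, by eigenvectors whose eigenvalues are
rational characters. -/
def IsRational : Prop := Algebra.adjoin k (⋃ m, (eigenspace ρ m : Set A)) = ⊤

/-- `a` is an eigenvector of all elements of the torus. -/
def IsEigenvector (a : A) : Prop := a ≠ 0 ∧ ∀ h, ∃ c : k, ρ h a = c • a

theorem character_injective [CharZero k] :
    Function.Injective (fun (m : Fin r → ℤ) (h : Torus k r) => (character m h : k)) := by
  intro m m' h
  funext i
  have h2 : (2 : k) ≠ 0 := two_ne_zero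
  have := congrFun h (Function.update 1 i (Units.mk0 2 h2))
  have e : ∀ m : Fin r → ℤ, character m (Function.update 1 i (Units.mk0 (2 : k) h2)) =
      (Units.mk0 2 h2) ^ m i := fun m => by
    simp only [character, MonoidHom.coe_mk, OneHom.coe_mk]
    rw [Finset.prod_eq_single i]
    · simp
    · intro j _ hj
      simp [Function.update_of_ne hj]
    · simp
  simp only [e, Units.val_zpow_eq_zpow_val, Units.val_mk0] at this
  have h' : ((2 : ℚ) ^ m i : ℚ) = 2 ^ m' i := by
    have : (((2 : ℚ) ^ m i : ℚ) : k) = ((2 ^ m' i : ℚ) : k) := by push_cast; exact this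
    exact_mod_cast this
  exact zpow_right_injective₀ (by norm_num) (by norm_num) h'

theorem iSupIndep_eigenspace [CharZero k] : iSupIndep (eigenspace ρ) := by
  have h := Module.End.independent_iInf_maxGenEigenspace_of_forall_mapsTo
    (fun h : Torus k r => (ρ h).toLinearMap) (fun h h' c =>
      Module.End.mapsTo_maxGenEigenspace_of_comm
        (by
          change (ρ h').toLinearMap * (ρ h).toLinearMap = (ρ h).toLinearMap * (ρ h').toLinearMap
          ext a
          change (ρ h' * ρ h) a = (ρ h * ρ h') a
          rw [← map_mul, ← map_mul, mul_comm]) c)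
  refine (h.comp character_injective).mono fun m a ha => ?_
  simp only [Function.comp_apply, Submodule.mem_iInf]
  intro g
  refine (Module.End.mem_maxGenEigenspace _ _ _).mpr ⟨1, ?_⟩
  simp [ha g]

theorem IsRational.iSup_eigenspace {ρ : Torus k r →* (A ≃ₐ[k] A)} (hρ : IsRational ρ) :
    ⨆ m, eigenspace ρ m = ⊤ := by
  have hle : ∀ m, eigenspace ρ m ≤ ⨆ m, eigenspace ρ m := le_iSup _
  rw [eq_top_iff]
  rintro a -
  have ha : a ∈ Algebra.adjoin k (⋃ m, (eigenspace ρ m : Set A)) := by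
    rw [show Algebra.adjoin k _ = ⊤ from hρ]; trivial
  induction ha using Algebra.adjoin_induction with
  | mem x hx =>
    obtain ⟨m, hm⟩ := Set.mem_iUnion.mp hx
    exact hle m hm
  | algebraMap c =>
    refine hle 0 fun h => ?_
    simp [character]
  | add x y _ _ hx hy => exact add_mem hx hy
  | mul x y _ _ hx hy =>
    have := Submodule.mul_mem_mul hx hy
    rw [Submodule.iSup_mul] at this
    refine (iSup_le fun m => ?_ : _ ≤ ⨆ m, eigenspace ρ m) this
    rw [Submodule.mul_iSup]
    refine iSup_le fun m' => Submodule.mul_le.mpr fun a ha b hb => hle (m + m') fun h => ?_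
    rw [map_mul, ha h, hb h, smul_mul_smul_comm]
    congr 1
    simp [character, zpow_add, Finset.prod_mul_distrib]

theorem IsRational.isInternal [CharZero k] {ρ : Torus k r →* (A ≃ₐ[k] A)} (hρ : IsRational ρ) :
    DirectSum.IsInternal (eigenspace ρ) :=
  (DirectSum.isInternal_submodule_iff_iSupIndep_and_iSup_eq_top _).mpr
    ⟨iSupIndep_eigenspace ρ, hρ.iSup_eigenspace⟩

/-- The differential of a rational torus action: the action on `A` of an element `η` of the Lie
algebra `kʳ` of the torus. On the eigenspace of the character with exponents `m` it is
multiplication by the scalar `∑ i, ηᵢ mᵢ`. -/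
def differential [CharZero k] {ρ : Torus k r →* (A ≃ₐ[k] A)} (hρ : IsRational ρ)
    (η : Fin r → k) : A →ₗ[k] A :=
  (DirectSum.toModule k (Fin r → ℤ) A
    (fun m => (∑ i, η i * (m i : k)) • (eigenspace ρ m).subtype)) ∘ₗ
  (LinearEquiv.ofBijective (DirectSum.coeLinearMap (eigenspace ρ)) hρ.isInternal).symm.toLinearMap

theorem differential_of_mem [CharZero k] {ρ : Torus k r →* (A ≃ₐ[k] A)} (hρ : IsRational ρ)
    (η : Fin r → k) {m : Fin r → ℤ} {a : A} (ha : a ∈ eigenspace ρ m) :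
    differential hρ η a = (∑ i, η i * (m i : k)) • a := by
  have : (LinearEquiv.ofBijective (DirectSum.coeLinearMap (eigenspace ρ)) hρ.isInternal).symm a =
      DirectSum.lof k _ (fun m => eigenspace ρ m) m ⟨a, ha⟩ := by
    rw [LinearEquiv.symm_apply_eq]
    exact (DirectSum.coeLinearMap_lof (eigenspace ρ) m ⟨a, ha⟩).symm
  simp only [differential, LinearMap.comp_apply, LinearEquiv.coe_coe, this,
    DirectSum.toModule_lof]
  rfl

end Torus

end

/-! The proof goes round a cycle of implications: locally closed, primitive, rational, locally
closed.

Locally closed implies primitive because `A` is a Jacobson ring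
(`isPoissonPrimitive_of_isLocallyClosed`). Primitive implies rational because, modulo the core `P`
of a maximal ideal `M`, no nonzero Poisson ideal lies in the image of `M`. A central fraction is
then regular at `M`, and so is the inverse of a nonzero one. It is therefore algebraic because its
value in the residue field is, by the Nullstellensatz (`isAlgebraic_center_fractions`).

Rational implies locally closed is where the torus enters. Every Poisson prime `Q` contains a
Poisson prime `J`, stable under the Lie algebra, with the same homogeneous elements
(`exists_mem_stablePrimes_le`). If a rational prime `P` lies in `Q` and contains the homogeneous
elements of `Q`, then `P = Q`: a shortest sum of homogeneous elements in `Q` but not in `P`, divided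
by one of its terms, would be a central fraction modulo `P` (`le_of_homogeneous_le`). If there are
only finitely many stable primes, one element outside `P` can be chosen in all of those not
contained in `P`, and it isolates `P`.

Finiteness is proved one variable at a time: over a prime of `k[x₀, …, xᵢ₋₁]` there are at most two
stable Poisson primes of `k[x₀, …, xᵢ]`, the extended one and one other. The uniqueness of the other
(`eq_of_stable_primes`) compares least-degree elements of two such primes over the quotient domain.
Normalized powers of them have a difference of lower degree satisfying the same differential
equations, and the nonzero eigenvalue of the variable forces that difference to vanish
(`eq_zero_of_isSemiInvariant`). -/

noncomputable section

/-! ### Ideals stable under derivations -/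

namespace Derivation

variable {k A : Type*} [Field k] [CommRing A] [Algebra k A]

theorem iterate_mul (d : Derivation k A A) (n : ℕ) (a b : A) :
    d^[n] (a * b) =
      ∑ ij ∈ Finset.HasAntidiagonal.antidiagonal n, (n.choose ij.1 : A) * (d^[ij.1] a * d^[ij.2] b) := by
  induction n with
  | zero => simp
  | succ n ih =>
    rw [Finset.sum_antidiagonal_choose_succ_mul (fun i j => d^[i] a * d^[j] b),
      Function.iterate_succ_apply', ih, map_sum, ← Finset.sum_add_distrib]
    refine Finset.sum_congr rfl fun ij hij => ?_
    rw [Finset.HasAntidiagonal.mem_antidiagonal] at hij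
    have e : n.choose ij.2 = n.choose ij.1 := by
      rw [← hij, add_comm, Nat.choose_symm_add]
    simp only [leibniz, smul_eq_mul, map_natCast, Function.iterate_succ_apply', e]
    ring

theorem iterate_mem_ideal (d : Derivation k A A) {I : Ideal A} (hI : ∀ a ∈ I, d a ∈ I) (n : ℕ) {a : A}
    (ha : a ∈ I) : d^[n] a ∈ I := by
  induction n with
  | zero => exact ha
  | succ n ih => rw [Function.iterate_succ_apply']; exact hI _ ih

/-- The largest ideal contained in `Q` that is stable under `d`. -/
def stableCore (d : Derivation k A A) (Q : Ideal A) : Ideal A where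
  carrier := {a | ∀ n, d^[n] a ∈ Q}
  zero_mem' n := by simp [iterate_map_zero]
  add_mem' {a b} ha hb n := by rw [iterate_map_add]; exact add_mem (ha n) (hb n)
  smul_mem' c a ha n := by
    rw [smul_eq_mul, iterate_mul]
    exact sum_mem fun ij _ => Q.mul_mem_left _ (Q.mul_mem_left _ (ha _))

theorem mem_stableCore {d : Derivation k A A} {Q : Ideal A} {a : A} :
    a ∈ d.stableCore Q ↔ ∀ n, d^[n] a ∈ Q := Iff.rfl

/-- Let `i` and `j` be least such that the `i`-th derivative of `a` and the `j`-th derivative of `b`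
lie outside `Q`. In the Leibniz expansion of the derivative of order `i + j` of `a * b`, every other
term lies in `Q`, and the binomial coefficient of the remaining one is invertible in characteristic
zero. -/
theorem isPrime_stableCore [CharZero k] (d : Derivation k A A) (Q : Ideal A) [hQ : Q.IsPrime] :
    (d.stableCore Q).IsPrime := by
  classical
  refine ⟨fun h => hQ.ne_top ?_, fun {a b} hab => ?_⟩
  · rw [Ideal.eq_top_iff_one] at h ⊢
    exact h 0
  · by_contra! hc
    simp only [mem_stableCore, not_forall] at hc
    have hi := Nat.find_spec hc.1
    have hj := Nat.find_spec hc.2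
    set i := Nat.find hc.1
    set j := Nat.find hc.2
    have hi' : ∀ m < i, d^[m] a ∈ Q := fun m hm => not_not.mp (Nat.find_min hc.1 hm)
    have hj' : ∀ m < j, d^[m] b ∈ Q := fun m hm => not_not.mp (Nat.find_min hc.2 hm)
    have h := hab (i + j)
    rw [iterate_mul, ← Finset.add_sum_erase _ _
      (Finset.HasAntidiagonal.mem_antidiagonal.mpr (rfl : (i, j).1 + (i, j).2 = i + j))] at h
    have h' := (Ideal.add_mem_iff_left Q (sum_mem fun x hx => ?_)).mp h
    · have hu : IsUnit (((i + j).choose i : ℕ) : A) := by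
        rw [← _root_.map_natCast (algebraMap k A)]
        refine (IsUnit.mk0 _ ?_).map _
        exact_mod_cast (Nat.choose_pos (Nat.le_add_right i j)).ne'
      rw [Ideal.unit_mul_mem_iff_mem _ hu] at h'
      exact (hQ.mem_or_mem h').elim hi hj
    · simp only [Finset.mem_erase, Finset.HasAntidiagonal.mem_antidiagonal, ne_eq, Prod.ext_iff] at hx
      refine Q.mul_mem_left _ ?_
      rcases lt_or_ge x.1 i with hlt | hge
      · exact Q.mul_mem_right _ (hi' _ hlt)
      · exact Q.mul_mem_left _ (hj' _ (by omega))

/-- In characteristic zero, the minimal primes over an ideal stable under a derivation are stable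
under it. -/
theorem mem_of_mem_minimalPrimes [CharZero k] (d : Derivation k A A) {I : Ideal A}
    (hI : ∀ a ∈ I, d a ∈ I) {P : Ideal A} (hP : P ∈ I.minimalPrimes) : ∀ a ∈ P, d a ∈ P := by
  have : P.IsPrime := hP.1.1
  have hle : d.stableCore P ≤ P := fun a ha => ha 0
  -- The stable core of `P` is a prime that still contains `I`, so minimality gives equality.
  have hge : P ≤ d.stableCore P :=
    hP.2 ⟨d.isPrime_stableCore P, fun a ha n => hP.1.2 (d.iterate_mem_ideal hI n ha)⟩ hle
  exact fun a ha => hge ha 1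

end Derivation

/-! ### Poisson cores of prime ideals -/

namespace PoissonBracket

variable {k A : Type*} [Field k] [CommRing A] [Algebra k A] (π : PoissonBracket k A)

theorem isPoissonIdeal_of_mem_minimalPrimes [CharZero k] {I : Ideal A} (hI : π.IsPoissonIdeal I) {P : Ideal A}
    (hP : P ∈ I.minimalPrimes) : π.IsPoissonIdeal P :=
  fun a => (π.ham a).mem_of_mem_minimalPrimes (hI a) hP

/-- A minimal prime over the core that lies in `Q` is again Poisson, hence equals the core by
maximality. -/
theorem isPrime_core [CharZero k] {Q : Ideal A} [Q.IsPrime] : (π.core Q).IsPrime := by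
  obtain ⟨P, hP, hPQ⟩ := Ideal.exists_minimalPrimes_le (π.isGreatest_core Q).1.2
  have h : P = π.core Q := le_antisymm
    ((π.isGreatest_core Q).2 ⟨π.isPoissonIdeal_of_mem_minimalPrimes (π.isGreatest_core Q).1.1 hP, hPQ⟩)
    hP.1.2
  exact h ▸ hP.1.1

/-! ### Locally closed points -/

theorem isLocallyClosed_singleton_iff (P : π.PSpec) :
    IsLocallyClosed {P} ↔ ∃ f ∉ P.1.asIdeal, ∀ Q : π.PSpec, P.1.asIdeal ≤ Q.1.asIdeal →
      f ∉ Q.1.asIdeal → Q = P := by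
  constructor
  · rintro ⟨U, Z, hU, hZ, h⟩
    have hP : P ∈ U ∩ Z := h ▸ Set.mem_singleton P
    obtain ⟨V, hV, rfl⟩ := isOpen_induced_iff.mp hU
    obtain ⟨_, ⟨f, rfl⟩, hf, hfV⟩ :=
      PrimeSpectrum.isTopologicalBasis_basic_opens.exists_subset_of_mem_open hP.1 hV
    refine ⟨f, hf, fun Q hPQ hfQ => ?_⟩
    have hQ : Q ∈ (Subtype.val ⁻¹' V : Set π.PSpec) ∩ Z := by
      refine ⟨hfV hfQ, ?_⟩
      -- An inclusion of primes is a specialization, and closed sets are stable under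
      -- specialization.
      have hs : P ⤳ Q := Topology.IsInducing.subtypeVal.specializes_iff.mp
        ((PrimeSpectrum.le_iff_specializes _ _).mp hPQ)
      exact hs.mem_closed hZ hP.2
    rw [← h] at hQ
    exact hQ
  · rintro ⟨f, hf, h⟩
    refine ⟨Subtype.val ⁻¹' (PrimeSpectrum.basicOpen f : Set (PrimeSpectrum A)),
      Subtype.val ⁻¹' PrimeSpectrum.zeroLocus (P.1.asIdeal : Set A),
      (PrimeSpectrum.basicOpen f).2.preimage continuous_subtype_val,
      (PrimeSpectrum.isClosed_zeroLocus _).preimage continuous_subtype_val, ?_⟩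
    ext Q
    constructor
    · rintro rfl
      exact ⟨hf, le_refl Q.1.asIdeal⟩
    · rintro ⟨h1, h2⟩
      exact h Q h2 h1

/-- In a Jacobson ring `P` is an intersection of maximal ideals, so some maximal `M` above `P` omits
the isolating element `f`. The core of `M` is a Poisson prime above `P` that omits `f`, so it is
`P`. -/
theorem isPoissonPrimitive_of_isLocallyClosed [CharZero k] [IsJacobsonRing A] (P : π.PSpec)
    (hP : IsLocallyClosed {P}) : π.IsPoissonPrimitive P.1.asIdeal := by
  obtain ⟨f, hf, h⟩ := (π.isLocallyClosed_singleton_iff P).mp hP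
  have hj : f ∉ P.1.asIdeal.jacobson := by
    rwa [isJacobsonRing_iff_prime_eq.mp ‹_› _ P.1.isPrime]
  simp only [Ideal.jacobson, Ideal.mem_sInf, not_forall] at hj
  obtain ⟨M, ⟨hPM, hM⟩, hfM⟩ := hj
  refine ⟨M, hM, ?_⟩
  have := hM.isPrime
  have hc := π.isGreatest_core M
  have := h ⟨⟨π.core M, π.isPrime_core⟩, hc.1.1⟩ (hc.2 ⟨P.2, hPM⟩) fun h => hfM (hc.1.2 h)
  exact (congrArg (fun Q : π.PSpec => Q.1.asIdeal) this).symm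

end PoissonBracket

end

noncomputable section

open Polynomial

namespace Polynomial

/-- Clearing denominators: the homogenization of `f` at `(a, b)` lives in `B`, so the values of `f`
at `a / b` in different `B`-algebras can be compared through one element of `B`. -/
theorem algebraMap_eval_scaleRoots {k B L : Type*} [CommRing k] [CommRing B] [Algebra k B]
    [CommRing L] [Algebra k L] [Algebra B L] [IsScalarTower k B L] (f : k[X]) (a b : B) {z : L}
    (hz : algebraMap B L b * z = algebraMap B L a) :
    algebraMap B L (eval a ((f.map (algebraMap k B)).scaleRoots b)) =
      algebraMap B L b ^ (f.map (algebraMap k B)).natDegree * aeval z f := by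
  have h := scaleRoots_eval₂_mul (p := f.map (algebraMap k B)) (algebraMap B L) z b
  rw [hz, eval₂_map, ← IsScalarTower.algebraMap_eq] at h
  rw [aeval_def, ← h, eval₂_at_apply]

end Polynomial

namespace PoissonBracket

/-! ### The Poisson center of a quotient field -/

section Fractions

variable {k B : Type*} [Field k] [CommRing B] [IsDomain B] [Algebra k B] (σ : PoissonBracket k B)
  (K : Type*) [Field K] [Algebra B K] [IsFractionRing B K] [Algebra k K] [IsScalarTower k B K]

theorem fractions_algebraMap (b c : B) :
    (σ.fractions K).bracket (algebraMap B K b) (algebraMap B K c) = algebraMap B K (σ.bracket b c) :=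
  (σ.eq_fractions_iff K _).mp rfl b c

theorem mem_center_fractions_iff {z : K} :
    z ∈ (σ.fractions K).center ↔ ∀ b : B, (σ.fractions K).bracket (algebraMap B K b) z = 0 := by
  constructor
  · intro hz b
    rw [skew, hz, neg_zero]
  · intro h y
    have : (σ.fractions K).ham z = 0 := Derivation.eq_of_eq_on_base B fun b => by
      rw [ham_apply, skew, h, neg_zero, Derivation.zero_apply]
    rw [← ham_apply, this, Derivation.zero_apply]

/-- The hypothesis is the vanishing of the numerator in the quotient rule for `{b, a / c}`. -/
theorem div_mem_center_fractions {a c : B} (hc : c ≠ 0)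
    (h : ∀ b, σ.bracket b a * c = a * σ.bracket b c) :
    algebraMap B K a / algebraMap B K c ∈ (σ.fractions K).center := by
  have hc' : algebraMap B K c ≠ 0 := by simpa using hc
  rw [mem_center_fractions_iff]
  intro b
  have hb := congrArg (algebraMap B K) (h b)
  set z := algebraMap B K a / algebraMap B K c with hz
  have e : algebraMap B K c * z = algebraMap B K a := by rw [hz]; field_simp
  have hl := (σ.fractions K).leibniz (algebraMap B K b) (algebraMap B K c) z
  rw [e, fractions_algebraMap, fractions_algebraMap] at hl
  rw [map_mul, map_mul, hl, ← e] at hb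
  have : algebraMap B K c * algebraMap B K c * (σ.fractions K).bracket (algebraMap B K b) z = 0 := by
    linear_combination hb
  simpa [hc'] using this

theorem inv_mem_center {L : Type*} [Field L] [Algebra k L] (τ : PoissonBracket k L) {z : L}
    (hz : z ∈ τ.center) : z⁻¹ ∈ τ.center := by
  by_cases h0 : z = 0
  · simp [h0]
  intro a
  have h := τ.leibniz_left z z⁻¹ a
  rw [mul_inv_cancel₀ h0, hz a, zero_mul, add_zero, ← map_one (algebraMap k L),
    (τ.center.algebraMap_mem 1 : _) a] at h
  simpa [h0] using h.symm

/-- If `M` contains no nonzero Poisson ideal, then the Poisson central fractions are regular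
at `M`. -/
theorem exists_denominator_notMem {M : Ideal B} (hM : ∀ I, σ.IsPoissonIdeal I → I ≤ M → I = ⊥)
    {z : K} (hz : z ∈ (σ.fractions K).center) :
    ∃ a b : B, b ∉ M ∧ algebraMap B K b * z = algebraMap B K a := by
  let I : Ideal B :=
    { carrier := {b | ∃ a, algebraMap B K b * z = algebraMap B K a}
      zero_mem' := ⟨0, by simp⟩
      add_mem' := by
        rintro b b' ⟨a, ha⟩ ⟨a', ha'⟩
        exact ⟨a + a', by rw [map_add, add_mul, ha, ha', map_add]⟩
      smul_mem' := by
        rintro c b ⟨a, ha⟩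
        exact ⟨c * a, by rw [smul_eq_mul, map_mul, mul_assoc, ha, map_mul]⟩ }
  -- The ideal `I` of denominators of `z` is nonzero, and it is Poisson: as `z` is central, `{c, b}
  -- z = {c, b z}`.
  by_contra! hc
  have hI : I ≤ M := fun b ⟨a, ha⟩ => by
    by_contra hb
    exact hc a b hb ha
  have hP : σ.IsPoissonIdeal I := by
    rintro c b ⟨a, ha⟩
    refine ⟨σ.bracket c a, ?_⟩
    rw [← fractions_algebraMap, ← fractions_algebraMap, ← ha, leibniz,
      (σ.mem_center_fractions_iff K).mp hz, mul_zero, add_zero]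
  obtain ⟨a, s, hs, rfl⟩ := IsFractionRing.div_surjective (A := B) z
  have hs' : algebraMap B K s ≠ 0 := IsFractionRing.to_map_ne_zero_of_mem_nonZeroDivisors hs
  have hsI : s ∈ I := ⟨a, by field_simp⟩
  rw [hM I hP hI, Ideal.mem_bot] at hsI
  exact hs' (by rw [hsI, map_zero])

/-- A central `z` has a value in the residue field at `M`, which is a root of some nonzero `f` over
`k`. If `f(z)` were nonzero, its inverse would be central, hence regular at `M`, although `f(z)`
vanishes there. -/
theorem isAlgebraic_center_fractions (M : Ideal B) [M.IsMaximal] [Algebra.IsAlgebraic k (B ⧸ M)]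
    (hM : ∀ I, σ.IsPoissonIdeal I → I ≤ M → I = ⊥) :
    Algebra.IsAlgebraic k (σ.fractions K).center := by
  refine ⟨fun ⟨z, hz⟩ => ?_⟩
  let _ : Field (B ⧸ M) := Ideal.Quotient.field M
  obtain ⟨a, b, hb, hab⟩ := σ.exists_denominator_notMem K hM hz
  have hb' : algebraMap B (B ⧸ M) b ≠ 0 := fun h => hb (Ideal.Quotient.eq_zero_iff_mem.mp h)
  obtain ⟨f, hf0, hf⟩ := Algebra.IsAlgebraic.isAlgebraic (R := k)
    (algebraMap B (B ⧸ M) a / algebraMap B (B ⧸ M) b)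
  refine ⟨f, hf0, Subtype.ext ?_⟩
  rw [aeval_subalgebra_coe]
  change aeval z f = 0
  by_contra hne
  have h1 := algebraMap_eval_scaleRoots f a b hab
  have h2 := algebraMap_eval_scaleRoots f a b (mul_div_cancel₀ (algebraMap B (B ⧸ M) a) hb')
  rw [hf, mul_zero] at h2
  set e := eval a ((f.map (algebraMap k B)).scaleRoots b)
  have heM : e ∈ M := Ideal.Quotient.eq_zero_iff_mem.mp h2
  have hfz : aeval z f ∈ (σ.fractions K).center := by
    have := (aeval (⟨z, hz⟩ : (σ.fractions K).center) f).2
    rwa [aeval_subalgebra_coe] at this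
  obtain ⟨a', b', hb'M, hab'⟩ := σ.exists_denominator_notMem K hM (inv_mem_center _ hfz)
  -- Multiplying out `f(z) * f(z)⁻¹ = 1` puts a product of elements outside `M` into `M`.
  have h3 : algebraMap B K (b ^ (f.map (algebraMap k B)).natDegree * b') = algebraMap B K (e * a') := by
    rw [map_mul, map_mul, h1, ← hab', map_pow]
    field_simp
  have h4 := IsFractionRing.injective B K h3
  have h5 : b ^ (f.map (algebraMap k B)).natDegree * b' ∈ M := h4 ▸ M.mul_mem_right _ heM
  have hp : M.IsPrime := Ideal.IsMaximal.isPrime ‹_›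
  exact (hp.mem_or_mem h5).elim (fun h => hb (hp.mem_of_pow_mem _ h)) hb'M

end Fractions

variable {k A : Type*} [Field k] [CommRing A] [Algebra k A] (π : PoissonBracket k A)

theorem isPoissonRational_of_eq_core [Algebra.FiniteType k A] (P : π.PSpec) {M : Ideal A}
    [hM : M.IsMaximal] (hP : P.1.asIdeal = π.core M) : π.IsPoissonRational P := by
  have hPM : P.1.asIdeal ≤ M := hP ▸ (π.isGreatest_core M).1.2
  have hs := Ideal.Quotient.mk_surjective (I := P.1.asIdeal)
  have hc : (M.map (Ideal.Quotient.mk P.1.asIdeal)).comap (Ideal.Quotient.mk P.1.asIdeal) = M := by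
    rw [Ideal.comap_map_of_surjective _ hs, ← RingHom.ker_eq_comap_bot, Ideal.mk_ker,
      sup_eq_left.mpr hPM]
  have : (M.map (Ideal.Quotient.mk P.1.asIdeal)).IsMaximal := by
    refine (Ideal.map_eq_top_or_isMaximal_of_surjective _ hs hM).resolve_left fun h => hM.ne_top ?_
    rw [← hc, h, Ideal.comap_top]
  let _ : Field ((A ⧸ P.1.asIdeal) ⧸ M.map (Ideal.Quotient.mk P.1.asIdeal)) := Ideal.Quotient.field _
  have : Algebra.FiniteType k ((A ⧸ P.1.asIdeal) ⧸ M.map (Ideal.Quotient.mk P.1.asIdeal)) :=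
    Algebra.FiniteType.of_surjective
      ((Ideal.Quotient.mkₐ k _).comp (Ideal.Quotient.mkₐ k P.1.asIdeal))
      (Ideal.Quotient.mk_surjective.comp hs)
  -- The Nullstellensatz: the residue field is finite over `k`.
  have := finite_of_finite_type_of_isJacobsonRing k
    ((A ⧸ P.1.asIdeal) ⧸ M.map (Ideal.Quotient.mk P.1.asIdeal))
  refine isAlgebraic_center_fractions _ _ (M.map (Ideal.Quotient.mk P.1.asIdeal)) fun I hI hIM => ?_
  have hle : I.comap (Ideal.Quotient.mk P.1.asIdeal) ≤ P.1.asIdeal := by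
    refine ((π.isGreatest_core M).2 ⟨fun a b hb => ?_, ?_⟩).trans_eq hP.symm
    · rw [Ideal.mem_comap, ← π.quotient_mk P.2]
      exact hI _ _ hb
    · exact (Ideal.comap_mono hIM).trans_eq hc
  rw [eq_bot_iff]
  intro x hx
  obtain ⟨x, rfl⟩ := hs x
  exact Ideal.Quotient.eq_zero_iff_mem.mpr (hle hx)

/-! ### Poisson rational primes -/

/-- The hypothesis makes `a / c` a central fraction modulo `P`, nonzero and so a root of a
polynomial over `k` with nonzero constant term. After clearing denominators every term except the
constant one times a power of `c` is divisible by `a`, hence lies in `Q`; so that power of `c` does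
too. -/
theorem mem_of_bracket_sub_mem_of_isPoissonRational {P : π.PSpec} (hP : π.IsPoissonRational P) {Q : Ideal A}
    (hPQ : P.1.asIdeal ≤ Q) [hQ : Q.IsPrime] {a c : A} (haQ : a ∈ Q) (haP : a ∉ P.1.asIdeal)
    (hcP : c ∉ P.1.asIdeal) (h : ∀ b, π.bracket b a * c - a * π.bracket b c ∈ P.1.asIdeal) :
    c ∈ Q := by
  set B := A ⧸ P.1.asIdeal
  set K := FractionRing B
  have hmk : ∀ {x : A}, algebraMap A B x = 0 ↔ x ∈ P.1.asIdeal := Ideal.Quotient.eq_zero_iff_mem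
  have hz : algebraMap B K (algebraMap A B a) / algebraMap B K (algebraMap A B c) ∈
      (π.residueBracket P).center := by
    refine div_mem_center_fractions _ _ (fun h => hcP (hmk.mp h)) fun b => ?_
    obtain ⟨b, rfl⟩ := Ideal.Quotient.mk_surjective b
    have := hmk.mpr (h b)
    rw [map_sub, sub_eq_zero, map_mul, map_mul] at this
    have hq : ∀ x, (π.quotient P.2).bracket (Ideal.Quotient.mk P.1.asIdeal b) (algebraMap A B x) =
        algebraMap A B (π.bracket b x) := π.quotient_mk P.2 b
    rw [hq, hq, this]
  have hc' : algebraMap A K c ≠ 0 := by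
    rw [IsScalarTower.algebraMap_apply A B K]
    simpa using fun h => hcP (hmk.mp h)
  have ha' : algebraMap A K a ≠ 0 := by
    rw [IsScalarTower.algebraMap_apply A B K]
    simpa using fun h => haP (hmk.mp h)
  rw [← IsScalarTower.algebraMap_apply, ← IsScalarTower.algebraMap_apply] at hz
  have halg : IsAlgebraic k (algebraMap A K a / algebraMap A K c) :=
    (hP.isAlgebraic ⟨_, hz⟩).algebraMap (A := K)
  obtain ⟨p, hp0, hp⟩ := halg.exists_nonzero_coeff_and_aeval_eq_zero
    (mem_nonZeroDivisors_of_ne_zero (div_ne_zero ha' hc'))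
  have h1 := algebraMap_eval_scaleRoots p a c (mul_div_cancel₀ (algebraMap A K a) hc')
  rw [hp, mul_zero, IsScalarTower.algebraMap_apply A B K, map_eq_zero_iff _ (IsFractionRing.injective B K),
    hmk] at h1
  set G := (p.map (algebraMap k A)).scaleRoots c with hG
  have h2 : eval a G - G.coeff 0 ∈ Q := by
    have : a - 0 ∣ eval a G - eval 0 G := sub_dvd_eval_sub a 0 G
    rw [sub_zero, ← coeff_zero_eq_eval_zero] at this
    exact Q.mem_of_dvd this haQ
  have h3 : G.coeff 0 ∈ Q := by simpa using sub_mem (hPQ h1) h2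
  rw [hG, coeff_scaleRoots, coeff_map] at h3
  have hu : IsUnit (algebraMap k A (p.coeff 0)) := (IsUnit.mk0 _ hp0).map _
  rw [Ideal.unit_mul_mem_iff_mem _ hu] at h3
  exact hQ.mem_of_pow_mem _ h3

/-! ### Poisson rational primes in a graded Poisson algebra -/

section Graded

variable {ι : Type*} [AddCommMonoid ι] {V : ι → Submodule k A} (hV : ⨆ m, V m = ⊤)
  (hmul : ∀ m m', ∀ a ∈ V m, ∀ b ∈ V m', a * b ∈ V (m + m'))
  (hbr : ∀ m m', ∀ a ∈ V m, ∀ b ∈ V m', π.bracket a b ∈ V (m + m'))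

include hV hmul hbr

/-- A Poisson rational Poisson prime cannot be enlarged to a Poisson prime without adding
homogeneous elements. -/
theorem le_of_homogeneous_le {P Q : π.PSpec} (hP : π.IsPoissonRational P)
    (hPQ : P.1.asIdeal ≤ Q.1.asIdeal)
    (h : ∀ m, ∀ a ∈ V m, a ∈ Q.1.asIdeal → a ∈ P.1.asIdeal) : Q.1.asIdeal ≤ P.1.asIdeal := by
  classical
  -- Induction on the number of summands. Their degrees may coincide, so the shorter sums produced
  -- below need no regrouping.
  have key : ∀ (s : Finset ι) (f : ι → A), (∀ j ∈ s, ∃ m, f j ∈ V m) →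
      ∑ j ∈ s, f j ∈ Q.1.asIdeal → ∑ j ∈ s, f j ∈ P.1.asIdeal := by
    intro s
    induction s using Finset.strongInduction with
    | H s ih =>
    intro f hf hQ
    by_contra hnP
    obtain ⟨i, his, hi⟩ : ∃ i ∈ s, f i ∉ P.1.asIdeal := by
      by_contra! hc
      exact hnP (sum_mem hc)
    obtain ⟨mi, hmi⟩ := hf i his
    refine hi (h mi _ hmi (π.mem_of_bracket_sub_mem_of_isPoissonRational hP hPQ hQ hnP hi fun b => ?_))
    have hb : b ∈ ⨆ m, V m := hV ▸ Submodule.mem_top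
    induction hb using Submodule.iSup_induction' with
    | zero => simp
    | add x y _ _ hx hy =>
      have := add_mem hx hy
      simp only [map_add, LinearMap.add_apply]
      convert this using 1
      ring
    | mem mb b hb =>
      -- The `i`-th summand cancels, leaving a shorter sum of homogeneous elements of `Q`, which
      -- lies in `P` by induction. So the sum divided by `f i` is central modulo `P`.
      have e : π.bracket b (∑ j ∈ s, f j) * f i - (∑ j ∈ s, f j) * π.bracket b (f i) =
          ∑ j ∈ s.erase i, (π.bracket b (f j) * f i - f j * π.bracket b (f i)) := by
        rw [map_sum, Finset.sum_mul, Finset.sum_mul, ← Finset.sum_sub_distrib,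
          ← Finset.add_sum_erase _ _ his]
        ring
      have hmem : π.bracket b (∑ j ∈ s, f j) * f i - (∑ j ∈ s, f j) * π.bracket b (f i) ∈
          Q.1.asIdeal :=
        sub_mem (Ideal.mul_mem_right _ _ (Q.2 _ _ hQ)) (Ideal.mul_mem_right _ _ hQ)
      rw [e] at hmem ⊢
      refine ih _ (Finset.erase_ssubset his) _ (fun j hj => ?_) hmem
      obtain ⟨mj, hmj⟩ := hf j (Finset.mem_of_mem_erase hj)
      refine ⟨mb + mj + mi, sub_mem (hmul _ _ _ (hbr _ _ _ hb _ hmj) _ hmi) ?_⟩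
      rw [add_comm mb mj, add_assoc]
      exact hmul _ _ _ hmj _ (hbr _ _ _ hb _ hmi)
  intro a ha
  have haV : a ∈ ⨆ m, V m := hV ▸ Submodule.mem_top
  obtain ⟨f, hf, rfl⟩ := (Submodule.mem_iSup_iff_exists_finsupp _ _).mp haV
  exact key f.support f (fun j _ => ⟨j, hf j⟩) ha

/-- The isolating element is a product of elements outside `P`, one from each member of `S` not
contained in `P`. If `Q` omits it, the member of `S` attached to `Q` lies in `P`, so `P` contains
the homogeneous elements of `Q`. -/
theorem isLocallyClosed_of_isPoissonRational {S : Set (Ideal A)} (hS : S.Finite)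
    (hSQ : ∀ Q : π.PSpec, ∃ J ∈ S, J ≤ Q.1.asIdeal ∧
      ∀ m, ∀ a ∈ V m, a ∈ Q.1.asIdeal → a ∈ J)
    (P : π.PSpec) (hP : π.IsPoissonRational P) : IsLocallyClosed {P} := by
  classical
  rw [isLocallyClosed_singleton_iff]
  have hc : ∀ J : Ideal A, ∃ f ∉ P.1.asIdeal, ¬ J ≤ P.1.asIdeal → f ∈ J := fun J => by
    by_cases hJ : J ≤ P.1.asIdeal
    -- Members of `S` inside `P` contribute the neutral factor `1`.
    · exact ⟨1, fun h => P.1.isPrime.ne_top (Ideal.eq_top_iff_one _ |>.mpr h), fun h => (h hJ).elim⟩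
    · obtain ⟨f, hf, hfP⟩ := Set.not_subset.mp hJ
      exact ⟨f, hfP, fun _ => hf⟩
  choose f hfP hfJ using hc
  refine ⟨∏ J ∈ hS.toFinset, f J, fun h => ?_, fun Q hPQ hQ => ?_⟩
  · obtain ⟨J, _, hJ⟩ := (P.1.isPrime.prod_mem_iff).mp h
    exact hfP J hJ
  · obtain ⟨J, hJS, hJQ, hJ⟩ := hSQ Q
    have hJP : J ≤ P.1.asIdeal := by
      by_contra hn
      refine hQ (Ideal.mem_of_dvd _ (Finset.dvd_prod_of_mem f (hS.mem_toFinset.mpr hJS)) ?_)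
      exact hJQ (hfJ J hn)
    have hQP := π.le_of_homogeneous_le hV hmul hbr hP hPQ fun m a ha haQ => hJP (hJ m a ha haQ)
    exact Subtype.ext (PrimeSpectrum.ext (le_antisymm hQP hPQ))

end Graded

end PoissonBracket

end

noncomputable section

open Polynomial

/-! ### Derivations of a polynomial ring of degree zero in the variable -/

namespace Derivation

variable {k D : Type*} [Field k] [CommRing D] [Algebra k D]

/-- The derivation of `D[X]` that extends `d` and maps `X` to `x * X + y`. -/
def polynomialExtension (d : Derivation k D D) (x y : D) : Derivation k D[X] D[X] :=
  Derivation.mk'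
    { toFun := fun q => PolynomialModule.equivPolynomialSelf (d.mapCoeffs q) +
        (C x * X + C y) * derivative q
      map_add' := fun p q => by simp only [map_add]; ring
      map_smul' := fun r q => by
        ext m
        simp [PolynomialModule.equivPolynomialSelf, smul_add] }
    (fun p q => by
      have := congrArg PolynomialModule.equivPolynomialSelf (d.mapCoeffs.leibniz p q)
      rw [map_add, LinearEquiv.map_smul, LinearEquiv.map_smul, smul_eq_mul, smul_eq_mul] at this
      simp only [LinearMap.coe_mk, AddHom.coe_mk, this, derivative_mul, smul_eq_mul]
      ring)

variable (d : Derivation k D D) (x y : D)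

theorem coeff_polynomialExtension (q : D[X]) (m : ℕ) :
    (d.polynomialExtension x y q).coeff m =
      d (q.coeff m) + x * (m * q.coeff m) + y * ((m + 1) * q.coeff (m + 1)) := by
  change (PolynomialModule.equivPolynomialSelf (d.mapCoeffs q) +
        (C x * X + C y) * derivative q).coeff m = _
  rw [coeff_add, add_mul, coeff_add, mul_assoc, coeff_C_mul, coeff_C_mul, ← add_assoc]
  congr 1
  · congr 1
    congr 1
    cases m with
    | zero => simp
    | succ m => rw [coeff_X_mul, coeff_derivative]; push_cast; ring
  · rw [coeff_derivative]; ring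

theorem polynomialExtension_C (c : D) : d.polynomialExtension x y (C c) = C (d c) := by
  ext m
  rw [coeff_polynomialExtension]
  cases m with
  | zero => simp
  | succ m => simp [coeff_C_succ]

theorem polynomialExtension_X : d.polynomialExtension x y X = C x * X + C y := by
  ext m
  rw [coeff_polynomialExtension, coeff_X, coeff_X, coeff_add, coeff_C_mul, coeff_X, coeff_C]
  rcases m with _ | _ | m <;> simp

theorem coeff_polynomialExtension_natDegree (q : D[X]) :
    (d.polynomialExtension x y q).coeff q.natDegree =
      d q.leadingCoeff + q.natDegree * x * q.leadingCoeff := by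
  rw [coeff_polynomialExtension, coeff_eq_zero_of_natDegree_lt (Nat.lt_succ_self _),
    coeff_natDegree]
  ring

theorem natDegree_polynomialExtension_le (q : D[X]) :
    (d.polynomialExtension x y q).natDegree ≤ q.natDegree := by
  rw [natDegree_le_iff_coeff_eq_zero]
  intro m hm
  rw [coeff_polynomialExtension, coeff_eq_zero_of_natDegree_lt hm,
    coeff_eq_zero_of_natDegree_lt (Nat.lt_succ_of_lt hm)]
  simp

/-- The polynomial `f` behaves under the extension of `d` as if it were `u * X ^ n` with `y = 0`. -/
def IsSemiInvariant (f : D[X]) (u : D) (n : ℕ) : Prop :=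
  C u * d.polynomialExtension x y f = C (d u + n * x * u) * f

variable {d x y}

theorem IsSemiInvariant.mul {f g : D[X]} {u v : D} {n m : ℕ} (hf : d.IsSemiInvariant x y f u n)
    (hg : d.IsSemiInvariant x y g v m) : d.IsSemiInvariant x y (f * g) (u * v) (n + m) := by
  unfold IsSemiInvariant at *
  simp only [leibniz, smul_eq_mul, map_mul, map_add, Nat.cast_add] at *
  linear_combination C v * g * hf + C u * f * hg

theorem IsSemiInvariant.pow {f : D[X]} {u : D} {n : ℕ} (hf : d.IsSemiInvariant x y f u n) (e : ℕ) :
    d.IsSemiInvariant x y (f ^ e) (u ^ e) (n * e) := by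
  induction e with
  | zero => simp [IsSemiInvariant]
  | succ e ih => rw [pow_succ, pow_succ, mul_add_one]; exact ih.mul hf

/-- When `u` and `v` are nonzero in a domain, semi-invariance says that `f / u` and `g / v` are
eigenvectors of the extended derivation with eigenvalue `n * x`. The conclusion is the same for
their difference `g / v - f / u`, over the denominator `u * v`. -/
theorem IsSemiInvariant.sub {f g : D[X]} {u v : D} {n : ℕ} (hf : d.IsSemiInvariant x y f u n)
    (hg : d.IsSemiInvariant x y g v n) :
    d.IsSemiInvariant x y (C u * g - C v * f) (u * v) n := by
  unfold IsSemiInvariant at *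
  simp only [leibniz, smul_eq_mul, map_mul, map_add, map_sub, polynomialExtension_C] at *
  linear_combination C u * C u * hg - C v * C v * hf

theorem IsSemiInvariant.leadingCoeff {h : D[X]} {w : D} {n : ℕ}
    (hh : d.IsSemiInvariant x y h w n) :
    w * (d h.leadingCoeff + h.natDegree * x * h.leadingCoeff) =
      (d w + n * x * w) * h.leadingCoeff := by
  have := congrArg (fun q => q.coeff h.natDegree) hh
  simpa only [coeff_C_mul, coeff_polynomialExtension_natDegree, coeff_natDegree] using this

/-- A nonconstant element of least degree of a stable ideal is semi-invariant. -/
theorem isSemiInvariant_of_minimal {P : Ideal D[X]}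
    (hP : ∀ q ∈ P, d.polynomialExtension x y q ∈ P) {f : D[X]} (hf : f ∈ P) (hf0 : f.natDegree ≠ 0)
    (hmin : ∀ q ∈ P, q.natDegree < f.natDegree → q = 0) :
    d.IsSemiInvariant x y f f.leadingCoeff f.natDegree := by
  refine sub_eq_zero.mp (hmin _ (sub_mem (P.mul_mem_left _ (hP f hf)) (P.mul_mem_left _ hf)) ?_)
  set g := C f.leadingCoeff * d.polynomialExtension x y f -
    C (d f.leadingCoeff + f.natDegree * x * f.leadingCoeff) * f with hg
  have hle : g.natDegree ≤ f.natDegree := by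
    refine (natDegree_sub_le _ _).trans (max_le ?_ (natDegree_C_mul_le _ _))
    exact (natDegree_C_mul_le _ _).trans (natDegree_polynomialExtension_le d x y f)
  -- The coefficient of `g` in the degree of `f` cancels. Equal degrees would then give `g = 0`, of
  -- `natDegree` zero, which is why `f` must be nonconstant.
  refine lt_of_le_of_ne hle fun he => hf0 ?_
  have h0 : g.coeff g.natDegree = 0 := by
    rw [he, hg, coeff_sub, coeff_C_mul, coeff_C_mul, coeff_polynomialExtension_natDegree,
      coeff_natDegree]
    ring
  rw [← he, leadingCoeff_eq_zero.mp h0, natDegree_zero]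

end Derivation

/-! ### Elements of least degree in ideals of a polynomial ring -/

namespace Polynomial

variable {D : Type*} [CommRing D]

theorem exists_minimal_natDegree {P : Ideal D[X]} (hP : P ≠ ⊥) :
    ∃ f ∈ P, f ≠ 0 ∧ ∀ q ∈ P, q.natDegree < f.natDegree → q = 0 := by
  classical
  obtain ⟨g, hg, hg0⟩ := Submodule.exists_mem_ne_zero_of_ne_bot hP
  have hex : ∃ n, ∃ f ∈ P, f ≠ 0 ∧ f.natDegree = n := ⟨_, g, hg, hg0, rfl⟩
  obtain ⟨f, hf, hf0, hfn⟩ := Nat.find_spec hex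
  refine ⟨f, hf, hf0, fun q hq hlt => ?_⟩
  by_contra hq0
  exact Nat.find_min hex (hfn ▸ hlt) ⟨q, hq, hq0, rfl⟩

/-- Pseudo-division by `f`: the leading coefficient of `f` is a nonzero constant, so it is not in
the prime `Q` and can be cancelled. -/
theorem le_of_minimal_mem {P Q : Ideal D[X]} [hQ : Q.IsPrime] (hQ0 : ∀ c, C c ∈ Q → c = 0)
    {f : D[X]} (hfP : f ∈ P) (hf0 : f ≠ 0) (hmin : ∀ q ∈ P, q.natDegree < f.natDegree → q = 0)
    (hfQ : f ∈ Q) : P ≤ Q := by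
  intro q
  induction hn : q.natDegree using Nat.strong_induction_on generalizing q with
  | _ n ih =>
  intro hq
  by_cases hlt : q.natDegree < f.natDegree
  · rw [hmin q hq hlt]; exact Q.zero_mem
  by_cases hq0 : q = 0
  · rw [hq0]; exact Q.zero_mem
  set r := C f.leadingCoeff * q - C q.leadingCoeff * X ^ (q.natDegree - f.natDegree) * f with hr
  have hrP : r ∈ P := sub_mem (P.mul_mem_left _ hq) (P.mul_mem_left _ hfP)
  have hrQ : r ∈ Q := by
    by_cases hr0 : r = 0
    · rw [hr0]; exact Q.zero_mem
    refine ih _ ?_ rfl hrP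
    rw [← hn]
    have hle : r.natDegree ≤ q.natDegree := by
      refine (natDegree_sub_le _ _).trans (max_le (natDegree_C_mul_le _ _) ?_)
      refine natDegree_mul_le.trans ?_
      have := natDegree_C_mul_X_pow_le q.leadingCoeff (q.natDegree - f.natDegree)
      omega
    refine lt_of_le_of_ne hle fun he => hr0 ?_
    rw [← leadingCoeff_eq_zero, leadingCoeff, he, hr, coeff_sub, coeff_C_mul, coeff_natDegree,
      mul_assoc, coeff_C_mul]
    have : (X ^ (q.natDegree - f.natDegree) * f).coeff q.natDegree = f.leadingCoeff := by
      rw [coeff_X_pow_mul', if_pos (Nat.sub_le _ _), Nat.sub_sub_self (not_lt.mp hlt),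
        coeff_natDegree]
    rw [this]
    ring
  have h1 : C f.leadingCoeff * q ∈ Q := by
    have := add_mem hrQ (Q.mul_mem_left (C q.leadingCoeff * X ^ (q.natDegree - f.natDegree)) hfQ)
    simpa [hr] using this
  exact (hQ.mem_or_mem h1).resolve_left fun h => hf0 (leadingCoeff_eq_zero.mp (hQ0 _ h))

end Polynomial

/-! ### Prime ideals of Poisson polynomial rings -/

namespace PoissonBracket

variable {k D : Type*} [Field k] [CommRing D] [IsDomain D] [Algebra k D]
  (σ : PoissonBracket k D) (α δ : Derivation k D D) (s : k)

/-- Let `p` be the leading coefficient and `m` the degree of `h`. Comparing leading coefficients for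
`b = p` and for `b = w` expresses `{p, w}` both as `(n - m) α(p) w` and as `(n - m) α(w) p`. The
equation for `α` itself says that `α(p) w - α(w) p = (n - m) s p w`, so `(n - m)² s p w = 0`. -/
theorem eq_zero_of_isSemiInvariant [CharZero k] (hs : s ≠ 0) {h : D[X]} {w : D} {n : ℕ}
    (hw : w ≠ 0) (hn : h.natDegree < n)
    (hσ : ∀ b, (-σ.ham b).IsSemiInvariant (α b) (δ b) h w n)
    (hα : α.IsSemiInvariant (algebraMap k D s) 0 h w n) : h = 0 := by
  rw [← leadingCoeff_eq_zero]
  by_contra hp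
  have h1 := (hσ h.leadingCoeff).leadingCoeff
  have h2 := (hσ w).leadingCoeff
  have h3 := hα.leadingCoeff
  simp only [Derivation.neg_apply, ham_apply, σ.self] at h1 h2
  rw [σ.skew w h.leadingCoeff] at h2
  set p := h.leadingCoeff
  set m := h.natDegree
  have e1 : σ.bracket p w = (n - m) * α p * w := mul_right_cancel₀ hp (by linear_combination h1)
  have e2 : σ.bracket p w = (n - m) * α w * p := mul_right_cancel₀ hw (by linear_combination h2)
  have e3 : ((n : D) - m) * ((n - m) * algebraMap k D s * p * w) = 0 := by
    linear_combination e2 - e1 - (n - m) * h3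
  have hD : ((n : D) - m) = algebraMap k D ((n : k) - m) := by simp
  have hnm : ((n : k) - m) ≠ 0 := by
    rw [sub_ne_zero]
    exact_mod_cast hn.ne'
  have hnm' : ((n : D) - m) ≠ 0 := by
    rw [hD]
    exact (map_ne_zero_iff _ (algebraMap k D).injective).mpr hnm
  simp [hnm', hp, hw, hs] at e3

/-- The ring `D[X]`, with the bracket given by `α` and `δ`, has at most one nonzero Poisson prime
that contracts to zero and is stable under the extension of `α` with `X ↦ s X`, if `s ≠ 0`. -/
theorem eq_of_stable_primes [CharZero k] (hs : s ≠ 0) {P Q : Ideal D[X]}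
    [hP : P.IsPrime] [hQ : Q.IsPrime] (hP0 : ∀ c, C c ∈ P → c = 0) (hQ0 : ∀ c, C c ∈ Q → c = 0)
    (hPne : P ≠ ⊥) (hQne : Q ≠ ⊥)
    (hPσ : ∀ b, ∀ q ∈ P, (-σ.ham b).polynomialExtension (α b) (δ b) q ∈ P)
    (hQσ : ∀ b, ∀ q ∈ Q, (-σ.ham b).polynomialExtension (α b) (δ b) q ∈ Q)
    (hPα : ∀ q ∈ P, α.polynomialExtension (algebraMap k D s) 0 q ∈ P)
    (hQα : ∀ q ∈ Q, α.polynomialExtension (algebraMap k D s) 0 q ∈ Q) : P = Q := by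
  obtain ⟨f, hf, hf0, hfmin⟩ := exists_minimal_natDegree hPne
  obtain ⟨g, hg, hg0, hgmin⟩ := exists_minimal_natDegree hQne
  have hdeg : ∀ {I : Ideal D[X]} {q : D[X]}, (∀ c, C c ∈ I → c = 0) → q ∈ I → q ≠ 0 →
      q.natDegree ≠ 0 := by
    intro I q hI hq hq0 h
    rw [eq_C_of_natDegree_eq_zero h] at hq hq0
    exact hq0 (by rw [hI _ hq, C_0])
  have hfd := hdeg hP0 hf hf0
  have hgd := hdeg hQ0 hg hg0
  have hu : f.leadingCoeff ≠ 0 := leadingCoeff_ne_zero.mpr hf0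
  have hv : g.leadingCoeff ≠ 0 := leadingCoeff_ne_zero.mpr hg0
  -- Up to a common denominator this is the difference of `g ^ deg f` and `f ^ deg g`, each divided
  -- by its leading coefficient; both have degree `deg f * deg g`, so the top terms cancel.
  set h := C (f.leadingCoeff ^ g.natDegree) * g ^ f.natDegree -
    C (g.leadingCoeff ^ f.natDegree) * f ^ g.natDegree with hh
  have hT : ∀ (d : Derivation k D D) (x y : D), (∀ q ∈ P, d.polynomialExtension x y q ∈ P) →
      (∀ q ∈ Q, d.polynomialExtension x y q ∈ Q) → d.IsSemiInvariant x y h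
        (f.leadingCoeff ^ g.natDegree * g.leadingCoeff ^ f.natDegree)
        (f.natDegree * g.natDegree) := fun d x y h1 h2 =>
    ((Derivation.isSemiInvariant_of_minimal h1 hf hfd hfmin).pow _).sub
      (mul_comm f.natDegree g.natDegree ▸
        (Derivation.isSemiInvariant_of_minimal h2 hg hgd hgmin).pow f.natDegree)
  have h0 : h = 0 := by
    by_contra hne
    have hlt : h.natDegree < f.natDegree * g.natDegree := by
      have hle : h.natDegree ≤ f.natDegree * g.natDegree := by
        refine (natDegree_sub_le _ _).trans (max_le ?_ ?_)
        · exact (natDegree_C_mul_le _ _).trans (natDegree_pow_le)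
        · refine (natDegree_C_mul_le _ _).trans ((natDegree_pow_le).trans_eq (mul_comm _ _))
      refine lt_of_le_of_ne hle fun he => hne ?_
      rw [← leadingCoeff_eq_zero, leadingCoeff, he, hh, coeff_sub, coeff_C_mul, coeff_C_mul,
        coeff_pow_mul_natDegree, mul_comm f.natDegree g.natDegree, coeff_pow_mul_natDegree]
      ring
    exact hne (σ.eq_zero_of_isSemiInvariant α δ s hs
      (mul_ne_zero (pow_ne_zero _ hu) (pow_ne_zero _ hv)) hlt
      (fun b => hT _ _ _ (hPσ b) (hQσ b)) (hT _ _ _ hPα hQα))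
  -- Since `h = 0`, each of the two primes contains the least-degree element of the other.
  rw [hh, sub_eq_zero] at h0
  have hgP : g ∈ P := by
    have : C (f.leadingCoeff ^ g.natDegree) * g ^ f.natDegree ∈ P :=
      h0 ▸ P.mul_mem_left _ (P.pow_mem_of_mem hf _ (Nat.pos_of_ne_zero hgd))
    exact hP.mem_of_pow_mem _ ((hP.mem_or_mem this).resolve_left fun h =>
      pow_ne_zero _ hu (hP0 _ h))
  have hfQ : f ∈ Q := by
    have : C (g.leadingCoeff ^ f.natDegree) * f ^ g.natDegree ∈ Q :=
      h0 ▸ Q.mul_mem_left _ (Q.pow_mem_of_mem hg _ (Nat.pos_of_ne_zero hfd))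
    exact hQ.mem_of_pow_mem _ ((hQ.mem_or_mem this).resolve_left fun h =>
      pow_ne_zero _ hv (hQ0 _ h))
  exact le_antisymm (le_of_minimal_mem hQ0 hf hf0 hfmin hfQ)
    (le_of_minimal_mem hP0 hg hg0 hgmin hgP)

end PoissonBracket

end

noncomputable section

open Polynomial

/-! ### Stable primes lying over a given prime -/

namespace Derivation

variable {k B : Type*} [Field k] [CommRing B] [Algebra k B]

/-- The derivation induced on the quotient by a stable ideal. -/
def quotient (d : Derivation k B B) {I : Ideal B} (hI : ∀ b ∈ I, d b ∈ I) :
    Derivation k (B ⧸ I) (B ⧸ I) :=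
  Derivation.mk'
    ((Submodule.Quotient.restrictScalarsEquiv k I).toLinearMap ∘ₗ
      (I.restrictScalars k).mapQ (I.restrictScalars k) d.toLinearMap hI ∘ₗ
      (Submodule.Quotient.restrictScalarsEquiv k I).symm.toLinearMap)
    (fun a b => by
      obtain ⟨a, rfl⟩ := Ideal.Quotient.mk_surjective a
      obtain ⟨b, rfl⟩ := Ideal.Quotient.mk_surjective b
      change Ideal.Quotient.mk I (d (a * b)) = Ideal.Quotient.mk I a * Ideal.Quotient.mk I (d b) +
        Ideal.Quotient.mk I b * Ideal.Quotient.mk I (d a)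
      rw [d.leibniz, map_add, smul_eq_mul, smul_eq_mul, map_mul, map_mul])

theorem quotient_mk (d : Derivation k B B) {I : Ideal B} (hI : ∀ b ∈ I, d b ∈ I) (b : B) :
    d.quotient hI (Ideal.Quotient.mk I b) = Ideal.Quotient.mk I (d b) := rfl

theorem map_polynomialExtension {D : Type*} [CommRing D] [Algebra k D] (φ : B →+* D)
    {d : Derivation k B B} {d' : Derivation k D D} (h : ∀ b, d' (φ b) = φ (d b)) (x y : B)
    (q : B[X]) :
    d'.polynomialExtension (φ x) (φ y) (q.map φ) = (d.polynomialExtension x y q).map φ := by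
  ext m
  simp [coeff_polynomialExtension, h]

/-- Evaluation at `t` intertwines the formal derivation of `B[X]` with `Δ`, so stability of an ideal
of `A` passes to its preimage in `B[X]`. -/
theorem aeval_polynomialExtension {A : Type*} [CommRing A] [Algebra k A] [Algebra B A]
    {d : Derivation k B B} {Δ : Derivation k A A}
    (h : ∀ b, Δ (algebraMap B A b) = algebraMap B A (d b)) {x y : B} {t : A}
    (ht : Δ t = algebraMap B A x * t + algebraMap B A y) (q : B[X]) :
    aeval t (d.polynomialExtension x y q) = Δ (aeval t q) := by
  induction q using Polynomial.induction_on with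
  | C a => rw [polynomialExtension_C, aeval_C, aeval_C, h]
  | add p q hp hq => rw [map_add, map_add, hp, hq, map_add, map_add]
  | monomial n a ih =>
    rw [pow_succ, ← mul_assoc]
    generalize C a * X ^ n = p at ih ⊢
    simp only [leibniz, polynomialExtension_X, map_mul, map_add, smul_eq_mul, aeval_X, aeval_C, ih, ht]

end Derivation

namespace PoissonBracket

variable {k A : Type*} [Field k] [CommRing A] [Algebra k A] (π : PoissonBracket k A)

/-- Some polynomial in `t` over `B` lies in `P`, but not all of its coefficients do. -/
def HasRelation (P : Ideal A) (B : Subalgebra k A) (t : A) : Prop :=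
  ∃ q : B[X], aeval t q ∈ P ∧ ∃ m, (q.coeff m : A) ∉ P

variable {B : Subalgebra k A} (hB : π.IsPoissonSubalgebra B) {α δ : Derivation k B B} {t : A}
  (hπ : ∀ b : B, π.bracket t (b : A) = (α b : A) * t + (δ b : A))
  {Δ : Derivation k A A} (hΔ : ∀ b : B, Δ (b : A) = (α b : A)) {s : k} (hΔt : Δ t = s • t)

include hB hπ hΔ hΔt

/-- Over a prime of `B` there is at most one stable Poisson prime of `B[t]` besides the one
generated by it. -/
theorem aeval_mem_iff_of_contraction_eq [CharZero k] (hs : s ≠ 0) {P₁ P₂ : Ideal A}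
    [hP₁ : P₁.IsPrime] [hP₂ : P₂.IsPrime] (hπ₁ : π.IsPoissonIdeal P₁) (hπ₂ : π.IsPoissonIdeal P₂)
    (hΔ₁ : ∀ a ∈ P₁, Δ a ∈ P₁) (hΔ₂ : ∀ a ∈ P₂, Δ a ∈ P₂)
    (hQ : ∀ b : B, (b : A) ∈ P₁ ↔ (b : A) ∈ P₂)
    (hR : HasRelation P₁ B t ↔ HasRelation P₂ B t) (q : B[X]) :
    aeval t q ∈ P₁ ↔ aeval t q ∈ P₂ := by
  by_cases hR₁ : HasRelation P₁ B t
  swap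
  -- Without a relation, membership in `P` is decided coefficientwise, hence by the contraction to
  -- `B`.
  · have aux : ∀ {P : Ideal A}, ¬ HasRelation P B t →
        (aeval t q ∈ P ↔ ∀ m, (q.coeff m : A) ∈ P) := by
      intro P hP
      constructor
      · intro h
        by_contra! hc
        exact hP ⟨q, h, hc⟩
      · intro h
        rw [aeval_eq_sum_range]
        exact sum_mem fun m _ => by rw [Subalgebra.smul_def]; exact P.mul_mem_right _ (h m)
    rw [aux hR₁, aux (hR₁ ∘ hR.mpr)]
    exact forall_congr' fun m => hQ _
  have hR₂ := hR.mp hR₁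
  set Q : Ideal B := P₁.comap B.subtype with hQdef
  have hmem₁ : ∀ {b : B}, b ∈ Q ↔ (b : A) ∈ P₁ := Iff.rfl
  have hmem₂ : ∀ {b : B}, b ∈ Q ↔ (b : A) ∈ P₂ := fun {b} => hQ b
  have hQπ : (π.restrict hB).IsPoissonIdeal Q := fun a b hb => hπ₁ a b hb
  have hQα : ∀ b ∈ Q, α b ∈ Q := fun b hb => by
    rw [hmem₁, ← hΔ]
    exact hΔ₁ _ hb
  -- Here `δ b` is recovered as `{t, b} - α(b) t`.
  have hQδ : ∀ b ∈ Q, δ b ∈ Q := fun b hb => by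
    have h := sub_mem (hπ₁ t b hb) (P₁.mul_mem_right t (hQα b hb))
    rw [hπ] at h
    rw [hmem₁]
    simpa using h
  set σ := (π.restrict hB).quotient hQπ
  set φ := Ideal.Quotient.mk Q
  have hφ : Function.Surjective φ := Ideal.Quotient.mk_surjective
  have hψ : Function.Surjective (mapRingHom φ) := map_surjective φ hφ
  -- With a relation, `P` corresponds to a nonzero prime of `(B ⧸ Q)[X]` that contracts to zero and
  -- inherits stability, so the uniqueness theorem over the domain `B ⧸ Q` applies.
  have main : ∀ P : Ideal A, P.IsPrime → π.IsPoissonIdeal P → (∀ a ∈ P, Δ a ∈ P) →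
      (∀ {b : B}, b ∈ Q ↔ (b : A) ∈ P) → HasRelation P B t → ∃ I : Ideal (B ⧸ Q)[X],
        I.IsPrime ∧ (∀ c, C c ∈ I → c = 0) ∧ I ≠ ⊥ ∧
        (∀ b, ∀ q ∈ I, (-σ.ham b).polynomialExtension (α.quotient hQα b) (δ.quotient hQδ b) q ∈ I) ∧
        (∀ q ∈ I, (α.quotient hQα).polynomialExtension (algebraMap k _ s) 0 q ∈ I) ∧
        ∀ q : B[X], q.map φ ∈ I ↔ aeval t q ∈ P := by
    intro P hP hPπ hPΔ hPQ hPR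
    set J : Ideal B[X] := P.comap (aeval (R := B) t) with hJ
    have hker : RingHom.ker (mapRingHom φ) ≤ J := by
      intro q hq
      rw [RingHom.mem_ker, coe_mapRingHom] at hq
      rw [hJ, Ideal.mem_comap, aeval_eq_sum_range]
      refine sum_mem fun m _ => ?_
      have : q.coeff m ∈ Q := by
        rw [← Ideal.Quotient.eq_zero_iff_mem]
        change φ (q.coeff m) = 0
        rw [← coeff_map, hq, coeff_zero]
      rw [Subalgebra.smul_def]
      exact P.mul_mem_right _ (hPQ.mp this)
    have hJp : J.IsPrime := Ideal.IsPrime.comap _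
    have hI : ∀ q : B[X], q.map φ ∈ J.map (mapRingHom φ) ↔ aeval t q ∈ P := by
      intro q
      have : (J.map (mapRingHom φ)).comap (mapRingHom φ) = J := by
        rw [Ideal.comap_map_of_surjective _ hψ, ← RingHom.ker_eq_comap_bot, sup_eq_left.mpr hker]
      rw [← coe_mapRingHom, ← Ideal.mem_comap, this, hJ, Ideal.mem_comap]
    refine ⟨J.map (mapRingHom φ), Ideal.map_isPrime_of_surjective hψ hker, ?_, ?_, ?_, ?_, hI⟩
    · intro c hc
      obtain ⟨c, rfl⟩ := hφ c
      rw [← map_C, hI, aeval_C] at hc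
      exact Ideal.Quotient.eq_zero_iff_mem.mpr (hPQ.mpr hc)
    · intro hbot
      obtain ⟨q, hq, m, hm⟩ := hPR
      rw [← hI, hbot, Ideal.mem_bot] at hq
      refine hm (hPQ.mp (Ideal.Quotient.eq_zero_iff_mem.mp ?_))
      change φ (q.coeff m) = 0
      rw [← coeff_map, hq, coeff_zero]
    · intro b q hq
      obtain ⟨b, rfl⟩ := hφ b
      obtain ⟨q, rfl⟩ := hψ q
      rw [coe_mapRingHom, hI] at hq
      -- The sign is forced: `-{b, -}` is the derivation that sends `t` to `{t, b} = α(b) t + δ(b)`.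
      rw [coe_mapRingHom, Derivation.quotient_mk, Derivation.quotient_mk,
        Derivation.map_polynomialExtension (d := -(π.restrict hB).ham b) (d' := -σ.ham (φ b)) φ ?_,
        hI, Derivation.aeval_polynomialExtension (Δ := -π.ham b) ?_ ?_]
      · exact P.neg_mem (hPπ _ _ hq)
      · intro c
        rfl
      · rw [Derivation.neg_apply, ham_apply, π.skew, neg_neg, hπ]
        rfl
      · intro c
        rw [Derivation.neg_apply, Derivation.neg_apply, map_neg]
        exact congrArg Neg.neg ((π.restrict hB).quotient_mk hQπ b c)
    · intro q hq
      obtain ⟨q, rfl⟩ := hψ q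
      rw [coe_mapRingHom, hI] at hq
      have h := Derivation.map_polynomialExtension (d := α) (d' := α.quotient hQα) φ
        (fun b => Derivation.quotient_mk _ _ _) (algebraMap k B s) 0 q
      rw [map_zero] at h
      have e : φ (algebraMap k B s) = algebraMap k (B ⧸ Q) s := rfl
      rw [coe_mapRingHom, ← e, h, hI, Derivation.aeval_polynomialExtension (Δ := Δ) ?_ ?_]
      · exact hPΔ _ hq
      · exact hΔ
      · rw [hΔt, ← IsScalarTower.algebraMap_apply, map_zero, add_zero, Algebra.smul_def]
  obtain ⟨I₁, hI₁, h0₁, hne₁, hσ₁, hα₁, hm₁⟩ := main P₁ hP₁ hπ₁ hΔ₁ hmem₁ hR₁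
  obtain ⟨I₂, hI₂, h0₂, hne₂, hσ₂, hα₂, hm₂⟩ := main P₂ hP₂ hπ₂ hΔ₂ hmem₂ hR₂
  have hQp : Q.IsPrime := Ideal.IsPrime.comap _
  rw [← hm₁, ← hm₂, σ.eq_of_stable_primes _ _ s hs h0₁ h0₂ hne₁ hne₂ hσ₁ hσ₂ hα₁ hα₂]

end PoissonBracket

end

noncomputable section

/-! ### Torus actions -/

namespace Torus

variable {k A : Type*} [Field k] [CommRing A] [Algebra k A] {r : ℕ} {ρ : Torus k r →* (A ≃ₐ[k] A)}

theorem character_add (m m' : Fin r → ℤ) (h : Torus k r) :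
    character (m + m') h = character m h * character m' h := by
  simp [character, zpow_add, Finset.prod_mul_distrib]

theorem mul_mem_eigenspace {m m' : Fin r → ℤ} {a b : A} (ha : a ∈ eigenspace ρ m)
    (hb : b ∈ eigenspace ρ m') : a * b ∈ eigenspace ρ (m + m') := fun h => by
  rw [map_mul, ha h, hb h, smul_mul_smul_comm, character_add, Units.val_mul]

theorem bracket_mem_eigenspace {π : PoissonBracket k A}
    (hρπ : ∀ h a b, ρ h (π.bracket a b) = π.bracket (ρ h a) (ρ h b)) {m m' : Fin r → ℤ} {a b : A}
    (ha : a ∈ eigenspace ρ m) (hb : b ∈ eigenspace ρ m') :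
    π.bracket a b ∈ eigenspace ρ (m + m') := fun h => by
  rw [hρπ, ha h, hb h, map_smul, map_smul, LinearMap.smul_apply, smul_smul, character_add,
    Units.val_mul, mul_comm]

variable [CharZero k]

/-- The differential of a rational torus action, as a derivation. -/
def differentialDer (hρ : IsRational ρ) (η : Fin r → k) : Derivation k A A :=
  Derivation.mk' (differential hρ η) fun a b => by
    have ha : a ∈ ⨆ m, eigenspace ρ m := hρ.iSup_eigenspace ▸ Submodule.mem_top
    have hb : b ∈ ⨆ m, eigenspace ρ m := hρ.iSup_eigenspace ▸ Submodule.mem_top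
    induction ha using Submodule.iSup_induction' with
    | zero => simp
    | add x y _ _ hx hy => rw [add_mul, map_add, hx, hy, map_add, smul_add, add_smul]; ring
    | mem m a ha =>
      induction hb using Submodule.iSup_induction' with
      | zero => simp
      | add x y _ _ hx hy => rw [mul_add, map_add, hx, hy, map_add, smul_add, add_smul]; ring
      | mem m' b hb =>
        rw [differential_of_mem hρ η (mul_mem_eigenspace ha hb), differential_of_mem hρ η ha,
          differential_of_mem hρ η hb]
        simp only [Pi.add_apply, Int.cast_add, mul_add, Finset.sum_add_distrib, smul_eq_mul,
          add_smul, mul_smul_comm, mul_comm b a]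
        rw [add_comm]

theorem differentialDer_apply (hρ : IsRational ρ) (η : Fin r → k) (a : A) :
    differentialDer hρ η a = differential hρ η a := rfl

/-- The prime Poisson ideals that are stable under the Lie algebra of the torus. -/
def stablePrimes (π : PoissonBracket k A) (hρ : IsRational ρ) : Set (Ideal A) :=
  {P | P.IsPrime ∧ π.IsPoissonIdeal P ∧ ∀ η, ∀ a ∈ P, differentialDer hρ η a ∈ P}

/-- Every Poisson prime contains a stable one with the same homogeneous elements. -/
theorem exists_mem_stablePrimes_le {π : PoissonBracket k A} (hρ : IsRational ρ)
    (hρπ : ∀ h a b, ρ h (π.bracket a b) = π.bracket (ρ h a) (ρ h b)) (Q : π.PSpec) :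
    ∃ J ∈ stablePrimes π hρ, J ≤ Q.1.asIdeal ∧
      ∀ m, ∀ a ∈ eigenspace ρ m, a ∈ Q.1.asIdeal → a ∈ J := by
  -- The homogeneous elements of `Q` generate an ideal that is both Poisson and stable under the Lie
  -- algebra.
  let s : Set A := {a | a ∈ Q.1.asIdeal ∧ ∃ m, a ∈ eigenspace ρ m}
  have hstable : ∀ d : Derivation k A A, (∀ a ∈ s, d a ∈ Ideal.span s) →
      ∀ a ∈ Ideal.span s, d a ∈ Ideal.span s := by
    intro d hd a ha
    induction ha using Submodule.span_induction with
    | mem a ha => exact hd a ha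
    | zero => simp
    | add x y _ _ hx hy => rw [map_add]; exact add_mem hx hy
    | smul c a ha h =>
      rw [smul_eq_mul, d.leibniz]
      exact add_mem (Ideal.mul_mem_left _ _ h) (Ideal.mul_mem_right _ _ ha)
  have hπ : π.IsPoissonIdeal (Ideal.span s) := by
    refine fun b => hstable (π.ham b) ?_
    rintro a ⟨haQ, m, ha⟩
    have hb : b ∈ ⨆ m, eigenspace ρ m := hρ.iSup_eigenspace ▸ Submodule.mem_top
    induction hb using Submodule.iSup_induction' with
    | zero => simp
    | add x y _ _ hx hy =>
      simp only [PoissonBracket.ham_apply, map_add, LinearMap.add_apply] at hx hy ⊢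
      exact add_mem hx hy
    | mem m' b hb =>
      exact Ideal.subset_span ⟨Q.2 _ _ haQ, _, bracket_mem_eigenspace hρπ hb ha⟩
  have hη : ∀ η, ∀ a ∈ Ideal.span s, differentialDer hρ η a ∈ Ideal.span s := by
    refine fun η => hstable _ ?_
    rintro a ⟨haQ, m, ha⟩
    rw [differentialDer_apply, differential_of_mem hρ η ha]
    exact Submodule.smul_of_tower_mem _ _ (Ideal.subset_span ⟨haQ, m, ha⟩)
  -- A minimal prime over the span inherits both kinds of stability, so primality of the span itself
  -- is not needed.
  obtain ⟨J, hJ, hJQ⟩ := Ideal.exists_minimalPrimes_le (I := Ideal.span s) (J := Q.1.asIdeal)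
    (Ideal.span_le.mpr fun a ha => ha.1)
  exact ⟨J, ⟨hJ.1.1, π.isPoissonIdeal_of_mem_minimalPrimes hπ hJ,
    fun η => (differentialDer hρ η).mem_of_mem_minimalPrimes (hη η) hJ⟩, hJQ,
    fun m a ha haQ => hJ.1.2 (Ideal.subset_span ⟨haQ, m, ha⟩)⟩

end Torus

/-! ### Finiteness of the set of stable primes -/

/-- On `s` the map `f` factors through `g`, so its image is no larger. -/
theorem Set.Finite.image_of_factor {α β γ : Type*} {s : Set α} {f : α → β} {g : α → γ}
    (hg : (g '' s).Finite) (h : ∀ x ∈ s, ∀ y ∈ s, g x = g y → f x = f y) : (f '' s).Finite := by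
  rcases s.eq_empty_or_nonempty with rfl | ⟨x₀, -⟩
  · simp
  have : Nonempty α := ⟨x₀⟩
  refine (hg.image fun c => f (Function.invFunOn g s c)).subset ?_
  rintro _ ⟨x, hx, rfl⟩
  have hgx : ∃ a ∈ s, g a = g x := ⟨x, hx, rfl⟩
  exact ⟨g x, ⟨x, hx, rfl⟩, h _ (Function.invFunOn_mem hgx) _ hx (Function.invFunOn_eq hgx)⟩

namespace MvPolynomial

/-- An element of `k[xⱼ : j ∈ insert i s]` is a polynomial in `xᵢ` over `k[xⱼ : j ∈ s]`. -/
theorem exists_aeval_eq_of_mem_supported_insert {k σ : Type*} [CommRing k] {s : Set σ} {i : σ}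
    {p : MvPolynomial σ k} (hp : p ∈ supported k (insert i s)) :
    ∃ q : Polynomial (supported k s), Polynomial.aeval (X i : MvPolynomial σ k) q = p := by
  change p ∈ Algebra.adjoin k (X '' insert i s) at hp
  induction hp using Algebra.adjoin_induction with
  | mem x hx =>
    obtain ⟨j, rfl | hj, rfl⟩ := hx
    · exact ⟨Polynomial.X, Polynomial.aeval_X _⟩
    · exact ⟨Polynomial.C ⟨X j, Algebra.subset_adjoin ⟨j, hj, rfl⟩⟩, Polynomial.aeval_C _ _⟩
  | algebraMap c =>
    exact ⟨Polynomial.C (algebraMap k _ c), Polynomial.aeval_C _ _⟩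
  | add x y _ _ hx hy =>
    obtain ⟨q, rfl⟩ := hx
    obtain ⟨q', rfl⟩ := hy
    exact ⟨q + q', map_add _ _ _⟩
  | mul x y _ _ hx hy =>
    obtain ⟨q, rfl⟩ := hx
    obtain ⟨q', rfl⟩ := hy
    exact ⟨q * q', map_mul _ _ _⟩

end MvPolynomial

open MvPolynomial

namespace IsIteratedPoissonPolynomialAlgebra

variable {k : Type*} [Field k] [CharZero k] {n r : ℕ} {π : PoissonBracket k (MvPolynomial (Fin n) k)}
  {α δ : ∀ i : Fin n, Derivation k (supported k (Set.Iio i)) (supported k (Set.Iio i))}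
  {ρ : Torus k r →* (MvPolynomial (Fin n) k ≃ₐ[k] MvPolynomial (Fin n) k)}
  (hρ : Torus.IsRational ρ) {η : Fin n → Fin r → k}
  (hα : ∀ i j, ∀ hji : j < i, Torus.differential hρ (η i) (X j) =
    (α i ⟨X j, Algebra.subset_adjoin ⟨j, hji, rfl⟩⟩ : MvPolynomial (Fin n) k))
  (hη : ∀ i, ∃ s : k, s ≠ 0 ∧ Torus.differential hρ (η i) (X i) = s • X i)

-- Both sides are derivations in `b`, and `hα` makes them agree on the generators `X j` with `j <
-- i`.
include hα in
theorem differentialDer_eq (i : Fin n) (b : supported k (Set.Iio i)) :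
    Torus.differentialDer hρ (η i) (b : MvPolynomial (Fin n) k) = (α i b : MvPolynomial (Fin n) k) := by
  obtain ⟨b, hb⟩ := b
  change b ∈ Algebra.adjoin k (X '' Set.Iio i) at hb
  induction hb using Algebra.adjoin_induction with
  | mem x hx =>
    obtain ⟨j, hj, rfl⟩ := hx
    exact hα i j hj
  | algebraMap c =>
    exact (Derivation.map_algebraMap _ c).trans
      (congrArg Subtype.val ((α i).map_algebraMap c)).symm
  | add x y hx hy h1 h2 =>
    have := congrArg Subtype.val ((α i).map_add ⟨x, hx⟩ ⟨y, hy⟩)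
    refine ((map_add _ x y).trans ?_).trans this.symm
    rw [h1, h2]
    rfl
  | mul x y hx hy h1 h2 =>
    have := congrArg Subtype.val ((α i).leibniz ⟨x, hx⟩ ⟨y, hy⟩)
    refine ((Derivation.leibniz _ x y).trans ?_).trans this.symm
    rw [h1, h2]
    rfl

variable (hA : IsIteratedPoissonPolynomialAlgebra π α δ)

include hA hα hη

/-- A stable prime of `k[x₀, …, xᵢ]` is determined, up to two choices, by its contraction to
`k[x₀, …, xᵢ₋₁]`. -/
theorem inter_supported_insert_eq (i : Fin n) {P₁ P₂ : Ideal (MvPolynomial (Fin n) k)}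
    (hP₁ : P₁ ∈ Torus.stablePrimes π hρ) (hP₂ : P₂ ∈ Torus.stablePrimes π hρ)
    (h : (P₁ ∩ supported k (Set.Iio i) : Set (MvPolynomial (Fin n) k)) =
      (P₂ ∩ supported k (Set.Iio i) : Set (MvPolynomial (Fin n) k)))
    (hR : PoissonBracket.HasRelation P₁ (supported k (Set.Iio i)) (X i) ↔
      PoissonBracket.HasRelation P₂ (supported k (Set.Iio i)) (X i)) :
    (P₁ ∩ supported k (insert i (Set.Iio i)) : Set (MvPolynomial (Fin n) k)) =
      (P₂ ∩ supported k (insert i (Set.Iio i)) : Set (MvPolynomial (Fin n) k)) := by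
  obtain ⟨s, hs, hsi⟩ := hη i
  have := hP₁.1
  have := hP₂.1
  have key := π.aeval_mem_iff_of_contraction_eq (hA.isPoissonSubalgebra i) (hA.bracket_X i)
    (Δ := Torus.differentialDer hρ (η i)) (differentialDer_eq hρ hα i) hsi hs hP₁.2.1 hP₂.2.1
    (hP₁.2.2 (η i)) (hP₂.2.2 (η i)) (fun b => by
      have := Set.ext_iff.mp h b
      simpa using this) hR
  ext p
  refine and_congr_left fun hp => ?_
  obtain ⟨q, rfl⟩ := exists_aeval_eq_of_mem_supported_insert hp
  exact key q

/-- Induction on the number of variables: the trace of a stable prime on the next subalgebra is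
determined by its trace on the previous one and the truth value of `HasRelation`, so each stage at
most doubles the count. -/
theorem finite_stablePrimes : (Torus.stablePrimes π hρ).Finite := by
  let F : ℕ → Ideal (MvPolynomial (Fin n) k) → Set (MvPolynomial (Fin n) k) :=
    fun i P => P ∩ supported k {j : Fin n | j.val < i}
  have hF : ∀ i ≤ n, (F i '' Torus.stablePrimes π hρ).Finite := by
    intro i
    induction i with
    | zero =>
      intro _
      refine Set.Subsingleton.finite ?_
      -- With no variables the subalgebra is the field `k`, which a proper ideal meets only in zero.
      have h0 : ∀ P ∈ Torus.stablePrimes π hρ, F 0 P = {0} := by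
        intro P hP
        ext p
        simp only [F, Nat.not_lt_zero, Set.ofPred_false, supported_empty, Set.mem_inter_iff,
          SetLike.mem_coe, Algebra.mem_bot, Set.mem_range, Set.mem_singleton_iff]
        constructor
        · rintro ⟨hp, c, rfl⟩
          by_contra hc
          have hc0 : c ≠ 0 := fun h => hc (by rw [h, map_zero])
          exact hP.1.ne_top (Ideal.eq_top_of_isUnit_mem _ hp ((IsUnit.mk0 c hc0).map _))
        · rintro rfl
          exact ⟨P.zero_mem, 0, map_zero _⟩
      rintro _ ⟨P, hP, rfl⟩ _ ⟨P', hP', rfl⟩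
      rw [h0 P hP, h0 P' hP']
    | succ i ih =>
      intro hi
      let i' : Fin n := ⟨i, hi⟩
      have e₁ : {j : Fin n | j.val < i} = Set.Iio i' := rfl
      have e₂ : {j : Fin n | j.val < i + 1} = insert i' (Set.Iio i') := by
        ext j
        simp only [Set.mem_ofPred_eq, Set.mem_insert_iff, Set.mem_Iio, Fin.ext_iff, Fin.lt_def, i']
        omega
      refine Set.Finite.image_of_factor
        -- The second component is a proposition, and `Prop` is a finite type.
        (g := fun P => (F i P, PoissonBracket.HasRelation P (supported k (Set.Iio i')) (X i'))) ?_ ?_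
      · refine ((ih (by omega)).prod (Set.finite_univ (α := Prop))).subset ?_
        rintro _ ⟨P, hP, rfl⟩
        exact ⟨⟨P, hP, rfl⟩, trivial⟩
      · intro P₁ hP₁ P₂ hP₂ h
        simp only [F, e₁, e₂, Prod.mk.injEq] at h ⊢
        exact hA.inter_supported_insert_eq hρ hα hη i' hP₁ hP₂ h.1 (iff_of_eq h.2)
  refine Set.Finite.of_finite_image (hF n le_rfl) fun P₁ _ P₂ _ h => SetLike.coe_injective ?_
  have e : {j : Fin n | j.val < n} = Set.univ := by ext j; simp
  simpa [F, e, supported_univ] using h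

end IsIteratedPoissonPolynomialAlgebra

end

/-! ### The Poisson Dixmier–Moeglin equivalence -/

theorem corollary1p8 {k : Type*} [Field k] [CharZero k] {n r : ℕ}
    (π : PoissonBracket k (MvPolynomial (Fin n) k))
    (α δ : ∀ i : Fin n, Derivation k (MvPolynomial.supported k (Set.Iio i))
      (MvPolynomial.supported k (Set.Iio i)))
    (hA : IsIteratedPoissonPolynomialAlgebra π α δ)
    (ρ : Torus k r →* (MvPolynomial (Fin n) k ≃ₐ[k] MvPolynomial (Fin n) k))
    (hρ : Torus.IsRational ρ)
    (hρπ : ∀ h a b, ρ h (π.bracket a b) = π.bracket (ρ h a) (ρ h b))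
    (hX : ∀ i, Torus.IsEigenvector ρ (MvPolynomial.X i))
    (η : Fin n → Fin r → k)
    (hα : ∀ i j, ∀ hji : j < i,
      Torus.differential hρ (η i) (MvPolynomial.X j) =
        (α i ⟨MvPolynomial.X j, Algebra.subset_adjoin ⟨j, hji, rfl⟩⟩ : MvPolynomial (Fin n) k))
    (hη : ∀ i, ∃ s : k, s ≠ 0 ∧
      Torus.differential hρ (η i) (MvPolynomial.X i) = s • MvPolynomial.X i) :
    π.DixmierMoeglinEquivalence := by
  -- The grading is by the characters of the torus; the finite set is that of the stable primes.
  have key : ∀ P : π.PSpec, π.IsPoissonRational P → IsLocallyClosed {P} :=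
    π.isLocallyClosed_of_isPoissonRational hρ.iSup_eigenspace
      (fun _ _ _ ha _ hb => Torus.mul_mem_eigenspace ha hb)
      (fun _ _ _ ha _ hb => Torus.bracket_mem_eigenspace hρπ ha hb)
      (hA.finite_stablePrimes hρ hα hη) (Torus.exists_mem_stablePrimes_le hρ hρπ)
  have primitive_rational : ∀ I, π.IsPoissonPrimitive I →
      ∃ P : π.PSpec, π.IsPoissonRational P ∧ P.1.asIdeal = I := by
    rintro _ ⟨M, hM, rfl⟩
    have := hM.isPrime
    exact ⟨⟨⟨π.core M, π.isPrime_core⟩, (π.isGreatest_core M).1.1⟩,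
      π.isPoissonRational_of_eq_core _ rfl, rfl⟩
  constructor
  · ext I
    constructor
    · intro hI
      obtain ⟨P, hP, rfl⟩ := primitive_rational I hI
      exact ⟨P, key P hP, rfl⟩
    · rintro ⟨P, hP, rfl⟩
      exact π.isPoissonPrimitive_of_isLocallyClosed P hP
  · ext I
    constructor
    · rintro ⟨P, hP, rfl⟩
      exact primitive_rational _ (π.isPoissonPrimitive_of_isLocallyClosed P hP)
    · rintro ⟨P, hP, rfl⟩
      exact ⟨P, key P hP, rfl⟩
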